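/- **Setting.** Team 1 has agents $\mathcal N^{(1)}=\{1,\dots,K_1\}$ and Team 2 has agents $\mathcal N^{(2)}=\{K_1+1,\dots,K_1+K_2\}$, with strategies $x\in\mathbb R^{M_1}$ and $y\in\mathbb R^{M_2}$. The combination matrices $A^{(1)},A^{(2)}$ are primitive and left-stochastic (nonnegative, columns summing to one), with Perron eigenvectors $A^{(t)}p^{(t)}=p^{(t)}$, $p^{(t)}>0$, $\mathbb 1^\top p^{(t)}=1$; let $p=[p^{(1)};p^{(2)}]$. The inference matrix $C=[C^{(1)},C^{(12)};C^{(21)},C^{(2)}]=(c_{\ell k})$ is left-stochastic, its diagonal blocks are irreducible (a $1\times1$ block counts as irreducible iff it is nonzero), and $c_{\ell k}>0$ for at least one $(\ell,k)\in\mathcal N^{(2)}\times\mathcal N^{(1)}$ and at least one $(\ell,k)\in\mathcal N^{(1)}\times\mathcal N^{(2)}$ (weak cross-team subgraph). Agent $k$ has a local risk $J_k(x,y)$; the team costs are $J^{(t)}=\sum_{k\in\mathcal N^{(t)}}p_kJ_k$. No relation between $J^{(1)}$ and $J^{(2)}$ is assumed. In addition every $k\in\mathcal N^{(1)}$ has a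 local risk $J^{(2)}_k$ modelling $J^{(2)}$, and every $k\in\mathcal N^{(2)}$ has a local risk $J_k^{(1)}$ modelling $J^{(1)}$. All these risks are differentiable in the variables in which their gradients are used below. There are constants $L_f\ge 0$, $G$ with: $\nabla_wJ_k$ is $L_f$-Lipschitz, i.e. $\|\nabla_wJ_k(x_1,y_1)-\nabla_wJ_k(x_2,y_2)\|\le L_f(\|x_1-x_2\|+\|y_1-y_2\|)$, and $\|\nabla_wJ_k-\nabla_wJ^{(t)}\|\le G$ everywhere, for $k\in\mathcal N^{(t)}$ and $w=x,y$; and $\nabla_yJ_k^{(2)}$ ($k\in\mathcal N^{(1)}$) and $\nabla_xJ_k^{(1)}$ ($k\in\mathcal N^{(2)}$) are $L_f$-Lipschitz in the same sense and differ from $\nabla_yJ^{(2)}$, resp. $\nabla_xJ^{(1)}$, by at most $G$ everywhere. **Algorithm** (step size $\mu>0$; all $x_{k,-1}=0$, $y_{k,-1}=0$). For $i=0,1,2,\dots$, hats denoting stochastic gradients evaluated at $(x_{k,i-1},y_{k,i-1})$: for $k\in\mathcal N^{(1)}$, $$\phi_{k,i}=x_{k,i-1}-\mu\widehat{\nabla_xJ}_k,\quad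 x_{k,i}=\sum_{\ell\in\mathcal N^{(1)}}a^{(1)}_{\ell k}\phi_{\ell,i},\quad \psi_{k,i}=y_{k,i-1}-\mu\widehat{\nabla_yJ}{}^{(2)}_k,\quad y_{k,i}=\sum_{\ell\in\mathcal N^{(2)}}c_{\ell k}y_{\ell,i}+\sum_{\ell\in\mathcal N^{(1)}}c_{\ell k}\psi_{\ell,i},$$ and for $k\in\mathcal N^{(2)}$, $$\phi_{k,i}=y_{k,i-1}-\mu\widehat{\nabla_yJ}_k,\quad y_{k,i}=\sum_{\ell\in\mathcal N^{(2)}}a^{(2)}_{\ell k}\phi_{\ell,i},\quad \psi_{k,i}=x_{k,i-1}-\mu\widehat{\nabla_xJ}{}^{(1)}_k,\quad x_{k,i}=\sum_{\ell\in\mathcal N^{(1)}}c_{\ell k}x_{\ell,i}+\sum_{\ell\in\mathcal N^{(2)}}c_{\ell k}\psi_{\ell,i}.$$ Conditioned on the $\sigma$-algebra generated by all iterates $(x_{k,j},y_{k,j})$ with $-1\le j\le i-1$, each of these stochastic gradients is unbiased for the corresponding gradient ($\nabla_xJ_k$, $\nabla_yJ_k^{(2)}$, $\nabla_yJ_k$,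 $\nabla_xJ_k^{(1)}$) and has variance at most $\sigma^2$. Let $x_{c,i}=\sum_{k\in\mathcal N^{(1)}}p_kx_{k,i}$, $y_{c,i}=\sum_{k\in\mathcal N^{(2)}}p_ky_{k,i}$, $z_{c,i}=[x_{c,i};y_{c,i}]$ and $F(z)=[\nabla_xJ^{(1)}(x,y);\nabla_yJ^{(2)}(x,y)]$. **Claim.** There is a constant $\alpha\in(0,1)$ depending only on $A^{(1)},A^{(2)},C$ such that, for every $\kappa>0$ and with $i_\alpha=\log(\kappa\mu^2)/\log\alpha$, the following holds, where the constants in $O(\cdot)$ and the bound on the step size do not depend on $\mu$, on $i$, on the probability space, or on the stochastic gradients. 1. (Consensus.) For all sufficiently small $\mu$ and all $i\ge i_\alpha$, $$\mathbb E\Big\{\sum_{k=1}^{K_1+K_2}\big(\|x_{k,i}-x_{c,i}\|^2+\|y_{k,i}-y_{c,i}\|^2\big)\Big\}\le O(\mu^2).$$ 2. (Learning dynamics.) For all sufficiently small $\mu$ and all $i\ge i_\alpha$, $z_{c,i}=z_{c,i-1}-\mu F(z_{c,i-1})+d_{c,i}$ with $\mathbb E\|d_{c,i}\|^2\le O(\mu^2)$.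 3. (Mean-square-error stability.) Suppose moreover that $(F(z_1)-F(z_2))^\top(z_1-z_2)\ge\nu\|z_1-z_2\|^2$ for all $z_1,z_2$, with a constant $\nu>0$. Then there is a unique Nash equilibrium $z^\star=[x^\star;y^\star]$, i.e. a unique point with $J^{(1)}(x^\star,y^\star)\le J^{(1)}(x,y^\star)$ for all $x$ and $J^{(2)}(x^\star,y^\star)\le J^{(2)}(x^\star,y)$ for all $y$. For all sufficiently small $\mu$ there is $d\in[0,1)$, depending only on $\mu,\nu,L_f$, with $$\mathbb E\|z_{c,i}-z^\star\|^2\le d\,\mathbb E\|z_{c,i-1}-z^\star\|^2+O(\mu^2)\quad\text{for all } i\ge i_\alpha,$$ and $\limsup_{i\to\infty}\mathbb E\|z_{c,i}-z^\star\|^2\le O(\mu)$. -/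

import Mathlib

open MeasureTheory Filter
open scoped BigOperators

noncomputable section

namespace CompetingNetworks

/-- The strategy space `ℝ^M` with its Euclidean norm. -/
abbrev Strat (M : ℕ) : Type := EuclideanSpace ℝ (Fin M)

/-- The agents of both teams: `Sum.inl k` is an agent of Team 1, `Sum.inr k` an agent of Team 2. -/
abbrev Agent (K₁ K₂ : ℕ) : Type := Fin K₁ ⊕ Fin K₂

/-- The pair `z = [x; y]` of the strategies of both teams, with its Euclidean norm. -/
abbrev JointStrat (M₁ M₂ : ℕ) : Type := WithLp 2 (Strat M₁ × Strat M₂)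

/-! ### The network -/

/-- Combination matrices `A₁ = A⁽¹⁾`, `A₂ = A⁽²⁾` and the inference matrix
`C = [C⁽¹⁾, C⁽¹²⁾; C⁽²¹⁾, C⁽²⁾]`. The entry `(ℓ, k)` weighs the information that flows from
agent `ℓ` to agent `k`. -/
structure Network (K₁ K₂ : ℕ) where
  A₁ : Matrix (Fin K₁) (Fin K₁) ℝ
  A₂ : Matrix (Fin K₂) (Fin K₂) ℝ
  C : Matrix (Agent K₁ K₂) (Agent K₁ K₂) ℝ

/-- The within-team matrices are primitive and left-stochastic; the inference matrix is
left-stochastic with irreducible diagonal blocks and at least one link in each direction between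
the teams (weak cross-team subgraph). -/
structure Network.IsWeak {K₁ K₂ : ℕ} (N : Network K₁ K₂) : Prop where
  primitive₁ : N.A₁.IsPrimitive
  primitive₂ : N.A₂.IsPrimitive
  leftStochastic₁ : N.A₁ ∈ Matrix.colStochastic ℝ (Fin K₁)
  leftStochastic₂ : N.A₂ ∈ Matrix.colStochastic ℝ (Fin K₂)
  leftStochastic : N.C ∈ Matrix.colStochastic ℝ (Agent K₁ K₂)
  irreducible₁ : N.C.toBlocks₁₁.IsIrreducible
  irreducible₂ : N.C.toBlocks₂₂.IsIrreducible
  link₂₁ : ∃ (l : Fin K₂) (k : Fin K₁), 0 < N.C (Sum.inr l) (Sum.inl k)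
  link₁₂ : ∃ (l : Fin K₁) (k : Fin K₂), 0 < N.C (Sum.inl l) (Sum.inr k)

/-- `p` is the Perron eigenvector of `A`: `A p = p`, positive entries that sum to one. -/
structure IsPerronVector {K : ℕ} (A : Matrix (Fin K) (Fin K) ℝ) (p : Fin K → ℝ) : Prop where
  eigen : A.mulVec p = p
  pos : ∀ k, 0 < p k
  sum_eq_one : ∑ k, p k = 1

/-! ### The game -/

section Gradients

variable {M₁ M₂ : ℕ}

/-- The partial gradient `∇ₓ f (x, y)`. -/
def gradX (f : Strat M₁ → Strat M₂ → ℝ) (x : Strat M₁) (y : Strat M₂) : Strat M₁ :=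
  gradient (fun x' => f x' y) x

/-- The partial gradient `∇_y f (x, y)`. -/
def gradY (f : Strat M₁ → Strat M₂ → ℝ) (x : Strat M₁) (y : Strat M₂) : Strat M₂ :=
  gradient (fun y' => f x y') y

/-- The gradient field `g` is `L`-Lipschitz in `(x, y)`. -/
def LipschitzField {E : Type*} [NormedAddCommGroup E] (L : ℝ)
    (g : Strat M₁ → Strat M₂ → E) : Prop :=
  ∀ x₁ x₂ y₁ y₂, ‖g x₁ y₁ - g x₂ y₂‖ ≤ L * (‖x₁ - x₂‖ + ‖y₁ - y₂‖)

/-- The gradient fields `g` and `h` disagree by at most `G` everywhere. -/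
def BoundedDisagreement {E : Type*} [NormedAddCommGroup E] (G : ℝ)
    (g h : Strat M₁ → Strat M₂ → E) : Prop :=
  ∀ x y, ‖g x y - h x y‖ ≤ G

end Gradients

/-- The risk functions. `J k` is the local risk of agent `k`. `Jopp₂ k`, for `k` in Team 1, is the
local risk `J_k⁽²⁾` by which agent `k` models the cost of Team 2, and `Jopp₁ k`, for `k` in Team 2,
is the local risk `J_k⁽¹⁾` by which agent `k` models the cost of Team 1. -/
structure Game (K₁ K₂ M₁ M₂ : ℕ) where
  J : Agent K₁ K₂ → Strat M₁ → Strat M₂ → ℝ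
  Jopp₂ : Fin K₁ → Strat M₁ → Strat M₂ → ℝ
  Jopp₁ : Fin K₂ → Strat M₁ → Strat M₂ → ℝ

namespace Game

variable {K₁ K₂ M₁ M₂ : ℕ}

/-- The global cost `J⁽¹⁾` of Team 1. -/
def cost₁ (𝒢 : Game K₁ K₂ M₁ M₂) (p₁ : Fin K₁ → ℝ) (x : Strat M₁) (y : Strat M₂) : ℝ :=
  ∑ k, p₁ k * 𝒢.J (Sum.inl k) x y

/-- The global cost `J⁽²⁾` of Team 2. -/
def cost₂ (𝒢 : Game K₁ K₂ M₁ M₂) (p₂ : Fin K₂ → ℝ) (x : Strat M₁) (y : Strat M₂) : ℝ :=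
  ∑ k, p₂ k * 𝒢.J (Sum.inr k) x y

/-- The global gradient operator `F(z) = [∇ₓ J⁽¹⁾(x, y); ∇_y J⁽²⁾(x, y)]`. -/
def F (𝒢 : Game K₁ K₂ M₁ M₂) (p₁ : Fin K₁ → ℝ) (p₂ : Fin K₂ → ℝ)
    (z : JointStrat M₁ M₂) : JointStrat M₁ M₂ :=
  WithLp.toLp 2 (gradX (𝒢.cost₁ p₁) z.fst z.snd, gradY (𝒢.cost₂ p₂) z.fst z.snd)

/-- `F` is `ν`-strongly monotone. -/
def StronglyMonotone (𝒢 : Game K₁ K₂ M₁ M₂) (p₁ : Fin K₁ → ℝ) (p₂ : Fin K₂ → ℝ) (ν : ℝ) :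
    Prop :=
  ∀ z₁ z₂ : JointStrat M₁ M₂,
    ν * ‖z₁ - z₂‖ ^ 2 ≤ inner ℝ (𝒢.F p₁ p₂ z₁ - 𝒢.F p₁ p₂ z₂) (z₁ - z₂)

/-- `z = [x; y]` is a Nash equilibrium of the two-team game. -/
def IsNash (𝒢 : Game K₁ K₂ M₁ M₂) (p₁ : Fin K₁ → ℝ) (p₂ : Fin K₂ → ℝ)
    (z : JointStrat M₁ M₂) : Prop :=
  (∀ x, 𝒢.cost₁ p₁ z.fst z.snd ≤ 𝒢.cost₁ p₁ x z.snd) ∧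
    ∀ y, 𝒢.cost₂ p₂ z.fst z.snd ≤ 𝒢.cost₂ p₂ z.fst y

/-- Differentiability, `L`-Lipschitz gradients and gradient disagreement at most `G`, for the local
risks of the agents and for their local models of the opposing team's cost. -/
structure Regular (𝒢 : Game K₁ K₂ M₁ M₂) (p₁ : Fin K₁ → ℝ) (p₂ : Fin K₂ → ℝ) (L G : ℝ) :
    Prop where
  diffX : ∀ k y, Differentiable ℝ fun x => 𝒢.J k x y
  diffY : ∀ k x, Differentiable ℝ fun y => 𝒢.J k x y
  lipX : ∀ k, LipschitzField L (gradX (𝒢.J k))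
  lipY : ∀ k, LipschitzField L (gradY (𝒢.J k))
  gapX₁ : ∀ k, BoundedDisagreement G (gradX (𝒢.J (Sum.inl k))) (gradX (𝒢.cost₁ p₁))
  gapY₁ : ∀ k, BoundedDisagreement G (gradY (𝒢.J (Sum.inl k))) (gradY (𝒢.cost₁ p₁))
  gapX₂ : ∀ k, BoundedDisagreement G (gradX (𝒢.J (Sum.inr k))) (gradX (𝒢.cost₂ p₂))
  gapY₂ : ∀ k, BoundedDisagreement G (gradY (𝒢.J (Sum.inr k))) (gradY (𝒢.cost₂ p₂))
  oppDiff₂ : ∀ k x, Differentiable ℝ fun y => 𝒢.Jopp₂ k x y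
  oppDiff₁ : ∀ k y, Differentiable ℝ fun x => 𝒢.Jopp₁ k x y
  oppLip₂ : ∀ k, LipschitzField L (gradY (𝒢.Jopp₂ k))
  oppLip₁ : ∀ k, LipschitzField L (gradX (𝒢.Jopp₁ k))
  oppGap₂ : ∀ k, BoundedDisagreement G (gradY (𝒢.Jopp₂ k)) (gradY (𝒢.cost₂ p₂))
  oppGap₁ : ∀ k, BoundedDisagreement G (gradX (𝒢.Jopp₁ k)) (gradX (𝒢.cost₁ p₁))

end Game

/-! ### The algorithm -/

/-- The stochastic gradients that the agents can evaluate, as random fields: the first argument is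
the iteration, the last the outcome. `own₁ i k` stands for `∇ₓ J_k` and `opp₂ i k` for
`∇_y J_k⁽²⁾`, with `k` in Team 1; `own₂ i k` stands for `∇_y J_k` and `opp₁ i k` for
`∇ₓ J_k⁽¹⁾`, with `k` in Team 2. -/
structure Oracles (K₁ K₂ M₁ M₂ : ℕ) (Ω : Type*) where
  own₁ : ℕ → Fin K₁ → Strat M₁ → Strat M₂ → Ω → Strat M₁
  opp₂ : ℕ → Fin K₁ → Strat M₁ → Strat M₂ → Ω → Strat M₂
  own₂ : ℕ → Fin K₂ → Strat M₁ → Strat M₂ → Ω → Strat M₂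
  opp₁ : ℕ → Fin K₂ → Strat M₁ → Strat M₂ → Ω → Strat M₁

/-- The strategies `x k` and `y k` that every agent `k` holds: its own team's strategy and the
inferred strategy of the opposing team. -/
structure State (K₁ K₂ M₁ M₂ : ℕ) where
  x : Agent K₁ K₂ → Strat M₁
  y : Agent K₁ K₂ → Strat M₂

section Algorithm

variable {K₁ K₂ M₁ M₂ : ℕ} {Ω : Type*}

/-- One iteration of ATC-ITC with the inference step based on the stochastic gradients of the
opposing team's cost: within-team adapt-then-combine, then cross-team infer-then-combine. -/
def step (N : Network K₁ K₂) (μ : ℝ) (𝒪 : Oracles K₁ K₂ M₁ M₂ Ω) (i : ℕ) (ω : Ω)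
    (s : State K₁ K₂ M₁ M₂) : State K₁ K₂ M₁ M₂ :=
  let φ₁ : Fin K₁ → Strat M₁ := fun k =>
    s.x (Sum.inl k) - μ • 𝒪.own₁ i k (s.x (Sum.inl k)) (s.y (Sum.inl k)) ω
  let φ₂ : Fin K₂ → Strat M₂ := fun k =>
    s.y (Sum.inr k) - μ • 𝒪.own₂ i k (s.x (Sum.inr k)) (s.y (Sum.inr k)) ω
  let X₁ : Fin K₁ → Strat M₁ := fun k => ∑ l, N.A₁ l k • φ₁ l
  let Y₂ : Fin K₂ → Strat M₂ := fun k => ∑ l, N.A₂ l k • φ₂ l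
  let ψ₁ : Fin K₁ → Strat M₂ := fun k =>
    s.y (Sum.inl k) - μ • 𝒪.opp₂ i k (s.x (Sum.inl k)) (s.y (Sum.inl k)) ω
  let ψ₂ : Fin K₂ → Strat M₁ := fun k =>
    s.x (Sum.inr k) - μ • 𝒪.opp₁ i k (s.x (Sum.inr k)) (s.y (Sum.inr k)) ω
  let Y₁ : Fin K₁ → Strat M₂ := fun k =>
    ∑ l, N.C (Sum.inr l) (Sum.inl k) • Y₂ l + ∑ l, N.C (Sum.inl l) (Sum.inl k) • ψ₁ l
  let X₂ : Fin K₂ → Strat M₁ := fun k =>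
    ∑ l, N.C (Sum.inl l) (Sum.inr k) • X₁ l + ∑ l, N.C (Sum.inr l) (Sum.inr k) • ψ₂ l
  { x := Sum.elim X₁ X₂, y := Sum.elim Y₁ Y₂ }

/-- The iterates, started at zero. The index is shifted by one: `iterate n` is the state with index
`n - 1`, so that `iterate 0` is the initial state (index `-1`) and iteration `i = 0, 1, …` leads
from `iterate i` to `iterate (i + 1)`. -/
def iterate (N : Network K₁ K₂) (μ : ℝ) (𝒪 : Oracles K₁ K₂ M₁ M₂ Ω) :
    ℕ → Ω → State K₁ K₂ M₁ M₂
  | 0, _ => { x := fun _ => 0, y := fun _ => 0 }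
  | i + 1, ω => step N μ 𝒪 i ω (iterate N μ 𝒪 i ω)

/-- The σ-algebra generated by all iterates of all agents before iteration `i`. -/
abbrev history (N : Network K₁ K₂) (μ : ℝ) (𝒪 : Oracles K₁ K₂ M₁ M₂ Ω) (i : ℕ) :
    MeasurableSpace Ω :=
  ⨆ (j : ℕ) (_ : j ≤ i) (k : Agent K₁ K₂),
    MeasurableSpace.comap (fun ω => ((iterate N μ 𝒪 j ω).x k, (iterate N μ 𝒪 j ω).y k))
      inferInstance

/-- The stochastic gradient `ghat`, evaluated at the random point `(x, y)`, is an estimate of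
`g (x, y)` that is unbiased and has variance at most `σ²`, conditioned on `ℱ`. -/
structure IsUnbiasedEstimate {E : Type*} [NormedAddCommGroup E] [InnerProductSpace ℝ E]
    [CompleteSpace E] [MeasurableSpace Ω] (P : Measure Ω) (ℱ : MeasurableSpace Ω)
    (ghat : Strat M₁ → Strat M₂ → Ω → E) (g : Strat M₁ → Strat M₂ → E) (σ : ℝ)
    (x : Ω → Strat M₁) (y : Ω → Strat M₂) : Prop where
  unbiased : P[fun ω => ghat (x ω) (y ω) ω | ℱ] =ᵐ[P] fun ω => g (x ω) (y ω)
  integrable : Integrable (fun ω => ‖ghat (x ω) (y ω) ω - g (x ω) (y ω)‖ ^ 2) P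
  variance : P[fun ω => ‖ghat (x ω) (y ω) ω - g (x ω) (y ω)‖ ^ 2 | ℱ] ≤ᵐ[P] fun _ => σ ^ 2

/-- The stochastic gradients are measurable and, at the iterates where the algorithm evaluates
them, unbiased with variance at most `σ²`, conditioned on the past. -/
structure Oracles.IsAdmissible [MeasurableSpace Ω] (𝒪 : Oracles K₁ K₂ M₁ M₂ Ω)
    (N : Network K₁ K₂) (𝒢 : Game K₁ K₂ M₁ M₂) (μ σ : ℝ) (P : Measure Ω) : Prop where
  meas_own₁ : ∀ i k, Measurable fun q : Strat M₁ × Strat M₂ × Ω => 𝒪.own₁ i k q.1 q.2.1 q.2.2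
  meas_opp₂ : ∀ i k, Measurable fun q : Strat M₁ × Strat M₂ × Ω => 𝒪.opp₂ i k q.1 q.2.1 q.2.2
  meas_own₂ : ∀ i k, Measurable fun q : Strat M₁ × Strat M₂ × Ω => 𝒪.own₂ i k q.1 q.2.1 q.2.2
  meas_opp₁ : ∀ i k, Measurable fun q : Strat M₁ × Strat M₂ × Ω => 𝒪.opp₁ i k q.1 q.2.1 q.2.2
  noise_own₁ : ∀ i k, IsUnbiasedEstimate P (history N μ 𝒪 i) (𝒪.own₁ i k)
    (gradX (𝒢.J (Sum.inl k))) σ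
    (fun ω => (iterate N μ 𝒪 i ω).x (Sum.inl k)) (fun ω => (iterate N μ 𝒪 i ω).y (Sum.inl k))
  noise_opp₂ : ∀ i k, IsUnbiasedEstimate P (history N μ 𝒪 i) (𝒪.opp₂ i k)
    (gradY (𝒢.Jopp₂ k)) σ
    (fun ω => (iterate N μ 𝒪 i ω).x (Sum.inl k)) (fun ω => (iterate N μ 𝒪 i ω).y (Sum.inl k))
  noise_own₂ : ∀ i k, IsUnbiasedEstimate P (history N μ 𝒪 i) (𝒪.own₂ i k)
    (gradY (𝒢.J (Sum.inr k))) σ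
    (fun ω => (iterate N μ 𝒪 i ω).x (Sum.inr k)) (fun ω => (iterate N μ 𝒪 i ω).y (Sum.inr k))
  noise_opp₁ : ∀ i k, IsUnbiasedEstimate P (history N μ 𝒪 i) (𝒪.opp₁ i k)
    (gradX (𝒢.Jopp₁ k)) σ
    (fun ω => (iterate N μ 𝒪 i ω).x (Sum.inr k)) (fun ω => (iterate N μ 𝒪 i ω).y (Sum.inr k))

/-- The centroid `x_c` of the strategies of Team 1. -/
def State.xc (s : State K₁ K₂ M₁ M₂) (p₁ : Fin K₁ → ℝ) : Strat M₁ :=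
  ∑ k, p₁ k • s.x (Sum.inl k)

/-- The centroid `y_c` of the strategies of Team 2. -/
def State.yc (s : State K₁ K₂ M₁ M₂) (p₂ : Fin K₂ → ℝ) : Strat M₂ :=
  ∑ k, p₂ k • s.y (Sum.inr k)

/-- The joint centroid `z_c = [x_c; y_c]`. -/
def State.zc (s : State K₁ K₂ M₁ M₂) (p₁ : Fin K₁ → ℝ) (p₂ : Fin K₂ → ℝ) : JointStrat M₁ M₂ :=
  WithLp.toLp 2 (s.xc p₁, s.yc p₂)

/-- `‖𝒳¹ - 𝒳_c‖² + ‖𝒴² - 𝒴_c‖² + ‖𝒳² - 𝒳'_c‖² + ‖𝒴¹ - 𝒴'_c‖²`. -/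
def State.consensusError (s : State K₁ K₂ M₁ M₂) (p₁ : Fin K₁ → ℝ) (p₂ : Fin K₂ → ℝ) : ℝ :=
  ∑ k : Fin K₁, ‖s.x (Sum.inl k) - s.xc p₁‖ ^ 2 + ∑ k : Fin K₂, ‖s.y (Sum.inr k) - s.yc p₂‖ ^ 2 +
    ∑ k : Fin K₂, ‖s.x (Sum.inr k) - s.xc p₁‖ ^ 2 + ∑ k : Fin K₁, ‖s.y (Sum.inl k) - s.yc p₂‖ ^ 2

end Algorithm

/-- The number of iterations `log (κ μ²) / log α` after which `α ^ i ≤ κ μ²`. -/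
def transient (α κ μ : ℝ) : ℝ := Real.log (κ * μ ^ 2) / Real.log α

end CompetingNetworks

end

open CompetingNetworks

universe u

/-! Each of the two strategies performs a single adapt-then-combine recursion over all agents of
both teams. Substituting the within-team combination into the inference step shows that estimates of
`x` are averaged with the column-stochastic matrix `chain₁`, whose blocks are `A₁`, `A₁ C₁₂`, `0`,
`C₂₂`: Team 1 leads and Team 2 follows. Estimates of `y` are averaged with `chain₂`, where the roles
are exchanged. The two recursions interact only through the points at which gradients are sampled.

Network part. The Perron vector of `chain₁` is `p₁` extended by zero, so the centroid of the whole
chain is the centroid of Team 1. Primitivity of the leaders, one link and irreducibility of the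
followers give a power of the chain with a positive row. Doeblin's argument then makes the powers of
`deviation B q`, that is `B - q 𝟙ᵀ`, tend to zero, and an adapted gauge `W` is contracted at each
round by a factor fixed by the network (`IsErgodic.exists_isContractedBy`).

Consensus. One step contracts `W` of the consensus error up to `μ` times the disagreement of the
search directions. This disagreement is at most `L` times the error itself, plus `G`, plus the
noise. For small `μ` the first term is absorbed by the contraction. As the iterates start in
agreement at zero, the mean-square error is of order `μ²` (`IsRun.integral_errSize_sq_le`).

Centroids. Mixing preserves the centroid, so `z_c` takes a gradient step, perturbed by `μ` times the
averaged noise and `μ` times a mismatch bounded by the consensus error. Under strong monotonicity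
the step contracts towards the unique zero of `F`, which is the Nash equilibrium. The noise is
orthogonal to the past and contributes only `μ²` times its variance, whence
`IsRun.integral_dist_zero_sq_le` and a limsup of order `μ² / μ`. -/

namespace CompetingNetworks

/-! ### Averaging matrices: reachability, Doeblin contraction, adapted norms. -/

section Chains

open Matrix

variable {ι : Type*} [Fintype ι]

/-- One round of averaging: agent `k` combines the vectors `e l` with the weights in column `k`. -/
noncomputable def mix {E : Type*} [AddCommGroup E] [Module ℝ E] (D : Matrix ι ι ℝ) (e : ι → E) :
    ι → E :=
  fun k => ∑ l, D l k • e l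

section Mix

variable {E : Type*} [AddCommGroup E] [Module ℝ E]

lemma mix_mix (D D' : Matrix ι ι ℝ) (e : ι → E) : mix D (mix D' e) = mix (D' * D) e := by
  funext k
  simp only [mix, Finset.smul_sum, smul_smul, Matrix.mul_apply, Finset.sum_smul]
  rw [Finset.sum_comm]
  simp only [mul_comm]

lemma mix_one [DecidableEq ι] (e : ι → E) : mix (1 : Matrix ι ι ℝ) e = e := by
  funext k
  simp [mix, Matrix.one_apply, ite_smul]

lemma mix_add (D : Matrix ι ι ℝ) (e f : ι → E) : mix D (e + f) = mix D e + mix D f := by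
  funext k
  simp [mix, Finset.sum_add_distrib]

end Mix

lemma norm_mix_le {E : Type*} [NormedAddCommGroup E] [NormedSpace ℝ E] {D : Matrix ι ι ℝ} {c : ℝ}
    (hc : 0 ≤ c) (hD : ∀ k, ∑ l, |D l k| ≤ c) (e : ι → E) : ‖mix D e‖ ≤ c * ‖e‖ := by
  refine (pi_norm_le_iff_of_nonneg (by positivity)).2 fun k => ?_
  calc ‖∑ l, D l k • e l‖ ≤ ∑ l, |D l k| * ‖e‖ := by
        refine (norm_sum_le _ _).trans (Finset.sum_le_sum fun l _ => ?_)
        rw [norm_smul, Real.norm_eq_abs]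
        exact mul_le_mul_of_nonneg_left (norm_le_pi_norm e l) (abs_nonneg _)
    _ ≤ c * ‖e‖ := by
        rw [← Finset.sum_mul]
        exact mul_le_mul_of_nonneg_right (hD k) (norm_nonneg _)

lemma exists_pos_of_mul_apply_pos {A B : Matrix ι ι ℝ} (hA : ∀ i j, 0 ≤ A i j)
    (hB : ∀ i j, 0 ≤ B i j) {i j : ι} (h : 0 < (A * B) i j) : ∃ l, 0 < A i l ∧ 0 < B l j := by
  rw [Matrix.mul_apply, Finset.sum_pos_iff_of_nonneg
    (fun x _ => mul_nonneg (hA i x) (hB x j))] at h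
  obtain ⟨l, -, hl⟩ := h
  exact ⟨l, pos_of_mul_pos_left hl (hB l j), pos_of_mul_pos_right hl (hA i l)⟩

lemma mul_apply_pos {κ ι' τ : Type*} [Fintype κ] {A : Matrix ι' κ ℝ} {B : Matrix κ τ ℝ}
    (hA : ∀ i j, 0 ≤ A i j) (hB : ∀ i j, 0 ≤ B i j) {i : ι'} {l : κ} {j : τ}
    (h : 0 < A i l) (h' : 0 < B l j) : 0 < (A * B) i j := by
  rw [Matrix.mul_apply]
  exact (mul_pos h h').trans_le (Finset.single_le_sum
    (f := fun x => A i x * B x j) (fun x _ => mul_nonneg (hA i x) (hB x j)) (Finset.mem_univ l))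

/-- A norm-like function that is equivalent to the norm of `ι → E` and contracted by `mix D`. -/
structure IsContractedBy {E : Type*} [NormedAddCommGroup E] [NormedSpace ℝ E]
    (D : Matrix ι ι ℝ) (ρ Γ : ℝ) (W : (ι → E) → ℝ) : Prop where
  continuous : Continuous W
  norm_le : ∀ e, ‖e‖ ≤ W e
  le_norm : ∀ e, W e ≤ Γ * ‖e‖
  add_le : ∀ e f, W (e + f) ≤ W e + W f
  mix_le : ∀ e, W (mix D e) ≤ ρ * W e

lemma IsContractedBy.mono {E : Type*} [NormedAddCommGroup E] [NormedSpace ℝ E]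
    {D : Matrix ι ι ℝ} {ρ ρ' Γ Γ' : ℝ} {W : (ι → E) → ℝ} (h : IsContractedBy D ρ Γ W)
    (hρ : ρ ≤ ρ') (hΓ : Γ ≤ Γ') : IsContractedBy D ρ' Γ' W where
  continuous := h.continuous
  norm_le := h.norm_le
  le_norm e := (h.le_norm e).trans (by gcongr)
  add_le := h.add_le
  mix_le e := (h.mix_le e).trans
    (mul_le_mul_of_nonneg_right hρ ((norm_nonneg e).trans (h.norm_le e)))

variable [DecidableEq ι]

/-- Walks of a subnetwork are walks of the network. -/
lemma pow_apply_pos_of_embed {κ : Type*} [Fintype κ] [DecidableEq κ] {A : Matrix κ κ ℝ}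
    {B : Matrix ι ι ℝ} (hA : ∀ i j, 0 ≤ A i j) (hB : ∀ i j, 0 ≤ B i j) (f : κ → ι)
    (hf : ∀ a b, 0 < A a b → 0 < B (f a) (f b)) (n : ℕ) :
    ∀ a b, 0 < (A ^ n) a b → 0 < (B ^ n) (f a) (f b) := by
  induction n with
  | zero =>
    intro a b h
    rcases eq_or_ne a b with rfl | hab
    · simp
    · simp [hab] at h
  | succ n ih =>
    intro a b h
    rw [pow_succ] at h ⊢
    obtain ⟨c, h₁, h₂⟩ := exists_pos_of_mul_apply_pos (Matrix.pow_apply_nonneg hA n) hA h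
    exact mul_apply_pos (Matrix.pow_apply_nonneg hB n) hB (ih a c h₁) (hf c b h₂)

lemma exists_col_pos {A : Matrix ι ι ℝ} (hA : A ∈ colStochastic ℝ ι) (k : ι) :
    ∃ l, 0 < A l k := by
  by_contra! h
  have h₁ := sum_col_of_mem_colStochastic hA k
  have h₂ := Finset.sum_nonpos fun l (_ : l ∈ Finset.univ) => h l
  linarith

/-- Primitivity provides one positive power. Positivity persists for later powers because no column
of a stochastic matrix vanishes. -/
lemma eventually_pow_pos_of_isPrimitive {A : Matrix ι ι ℝ} (hA : A.IsPrimitive)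
    (hs : A ∈ colStochastic ℝ ι) (a b : ι) : ∀ᶠ n in atTop, 0 < (A ^ n) a b := by
  obtain ⟨k, -, hk⟩ := hA.exists_pos_pow
  refine eventually_atTop.2 ⟨k, fun n hn => ?_⟩
  induction n, hn using Nat.le_induction generalizing b with
  | base => exact hk a b
  | succ n _ ih =>
    rw [pow_succ]
    obtain ⟨c, hc⟩ := exists_col_pos hs b
    exact mul_apply_pos (Matrix.pow_apply_nonneg hA.nonneg n) hA.nonneg (ih c) hc

/-- If a primitive group of agents feeds an irreducible group of agents, then every agent of the
former eventually reaches every agent of the network, after any sufficiently long time. -/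
lemma eventually_pow_pos_of_leader_follower {κ₁ κ₂ : Type*} [Fintype κ₁] [DecidableEq κ₁]
    [Fintype κ₂] [DecidableEq κ₂] {A : Matrix κ₁ κ₁ ℝ} {R : Matrix κ₂ κ₂ ℝ} {B : Matrix ι ι ℝ}
    (hB : ∀ i j, 0 ≤ B i j) (hA : A.IsPrimitive) (hs : A ∈ colStochastic ℝ κ₁)
    (hR : R.IsIrreducible) (f : κ₁ → ι) (g : κ₂ → ι)
    (hfg : ∀ i, (∃ a, f a = i) ∨ ∃ b, g b = i)
    (hf : ∀ a b, 0 < A a b → 0 < B (f a) (f b)) (hg : ∀ a b, 0 < R a b → 0 < B (g a) (g b))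
    (link : ∃ a b, 0 < B (f a) (g b)) (a : κ₁) (i : ι) :
    ∀ᶠ n in atTop, 0 < (B ^ n) (f a) i := by
  have h₁ : ∀ b, ∀ᶠ n in atTop, 0 < (B ^ n) (f a) (f b) := fun b =>
    (eventually_pow_pos_of_isPrimitive hA hs a b).mono fun n hn =>
      pow_apply_pos_of_embed hA.nonneg hB f hf n a b hn
  rcases hfg i with ⟨b, rfl⟩ | ⟨b, rfl⟩
  · exact h₁ b
  · obtain ⟨c, c', hc⟩ := link
    obtain ⟨j, -, hj⟩ := (isIrreducible_iff_exists_pow_pos hR.nonneg).1 hR c' b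
    have hj' := pow_apply_pos_of_embed hR.nonneg hB g hg j c' b hj
    -- The walk spends `n` rounds among the leaders, crosses one link, then follows a fixed path of
    -- length `j`. The followers may be periodic; since `n` is any large number, all long total
    -- lengths still occur.
    have h₂ : ∀ᶠ n in atTop, 0 < (B ^ (n + (1 + j))) (f a) (g b) := by
      filter_upwards [h₁ c] with n hn
      rw [pow_add, pow_add, pow_one]
      exact mul_apply_pos (Matrix.pow_apply_nonneg hB n)
        (by rw [← pow_succ']; exact Matrix.pow_apply_nonneg hB _) hn
        (mul_apply_pos hB (Matrix.pow_apply_nonneg hB j) hc hj')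
    rw [eventually_atTop] at h₂ ⊢
    obtain ⟨n₀, hn₀⟩ := h₂
    refine ⟨n₀ + (1 + j), fun n hn => ?_⟩
    have := hn₀ (n - (1 + j)) (by omega)
    rwa [Nat.sub_add_cancel (by omega)] at this

/-- Doeblin's condition: a column-stochastic matrix with a row bounded below by `δ` contracts the
`ℓ¹` norm of vectors with sum zero by the factor `1 - δ`. -/
lemma sum_abs_mulVec_le {P : Matrix ι ι ℝ} (hP : P ∈ colStochastic ℝ ι) {l₀ : ι} {δ : ℝ}
    (hδ : ∀ k, δ ≤ P l₀ k) {y : ι → ℝ} (hy : ∑ k, y k = 0) :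
    ∑ l, |(P *ᵥ y) l| ≤ (1 - δ) * ∑ k, |y k| := by
  -- Removing `δ` from row `l₀` leaves a nonnegative matrix with column sums `1 - δ`, and it does
  -- not change the image of a vector with sum zero.
  have hn : ∀ l k, 0 ≤ P l k - if l = l₀ then δ else 0 := by
    intro l k
    split_ifs with h
    · subst h; linarith [hδ k]
    · simpa using nonneg_of_mem_colStochastic hP
  have key : ∀ l, |(P *ᵥ y) l| ≤ ∑ k, (P l k - if l = l₀ then δ else 0) * |y k| := by
    intro l
    have : (P *ᵥ y) l = ∑ k, (P l k - if l = l₀ then δ else 0) * y k := by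
      simp only [sub_mul, Finset.sum_sub_distrib, ← Finset.mul_sum, hy, mul_zero, sub_zero]
      rfl
    rw [this]
    refine (Finset.abs_sum_le_sum_abs _ _).trans (le_of_eq (Finset.sum_congr rfl fun k _ => ?_))
    rw [abs_mul, abs_of_nonneg (hn l k)]
  refine (Finset.sum_le_sum fun l _ => key l).trans (le_of_eq ?_)
  rw [Finset.sum_comm, Finset.mul_sum]
  refine Finset.sum_congr rfl fun k _ => ?_
  rw [← Finset.sum_mul, Finset.sum_sub_distrib, sum_col_of_mem_colStochastic hP]
  simp

lemma sum_abs_pow_mulVec_le {P : Matrix ι ι ℝ} (hP : P ∈ colStochastic ℝ ι) {l₀ : ι} {δ : ℝ}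
    (hδ : ∀ k, δ ≤ P l₀ k) {y : ι → ℝ} (hy : ∑ k, y k = 0) (n : ℕ) :
    ∑ l, |((P ^ n) *ᵥ y) l| ≤ (1 - δ) ^ n * ∑ k, |y k| := by
  have h1 : δ ≤ 1 := (hδ l₀).trans (le_one_of_mem_colStochastic hP)
  induction n with
  | zero => simp
  | succ n ih =>
    rw [pow_succ', ← Matrix.mulVec_mulVec, pow_succ', mul_assoc]
    refine (sum_abs_mulVec_le hP hδ ?_).trans (mul_le_mul_of_nonneg_left ih (by linarith))
    rw [sum_mulVec_of_mem_colStochastic (pow_mem hP n), hy]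

/-- The deviation of the column-stochastic matrix `B` from its Perron projection `q 𝟙ᵀ`. -/
noncomputable def deviation (B : Matrix ι ι ℝ) (q : ι → ℝ) : Matrix ι ι ℝ := Matrix.of fun l k => B l k - q l

/-- The projection `q 𝟙ᵀ` is idempotent and absorbs `B` from both sides, so the cross terms
collapse. The exponent starts at one: the zeroth powers differ by the projection itself. -/
lemma deviation_pow {B : Matrix ι ι ℝ} {q : ι → ℝ} (hB : B ∈ colStochastic ℝ ι)
    (hq : B *ᵥ q = q) (hq₁ : ∑ k, q k = 1) (n : ℕ) :
    deviation B q ^ (n + 1) = deviation (B ^ (n + 1)) q := by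
  induction n with
  | zero => simp
  | succ n ih =>
    rw [pow_succ', ih]
    ext l k
    have h₀ : ∑ j, B l j * (B ^ (n + 1)) j k = (B ^ (n + 1 + 1)) l k := by
      rw [pow_succ' B (n + 1), Matrix.mul_apply]
    simp only [deviation, Matrix.mul_apply, Matrix.of_apply, sub_mul, mul_sub,
      Finset.sum_sub_distrib]
    have h₁ : ∑ j, B l j * q j = q l := congrFun hq l
    have h₂ : ∑ j, q l * (B ^ (n + 1)) j k = q l := by
      rw [← Finset.mul_sum, sum_col_of_mem_colStochastic (pow_mem hB _), mul_one]
    have h₃ : ∑ j, q l * q j = q l := by rw [← Finset.mul_sum, hq₁, mul_one]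
    rw [h₀, h₁, h₂, h₃]
    ring

/-- Data of an averaging chain: a column-stochastic matrix `B` with Perron probability vector `q`,
such that from some agent all others are reached simultaneously. -/
structure IsErgodic (B : Matrix ι ι ℝ) (q : ι → ℝ) : Prop where
  stochastic : B ∈ colStochastic ℝ ι
  eigen : B *ᵥ q = q
  nonneg : ∀ k, 0 ≤ q k
  sum_eq_one : ∑ k, q k = 1
  reach : ∃ l, ∀ k, ∀ᶠ n in atTop, 0 < (B ^ n) l k

lemma IsErgodic.exists_deviation_pow_le_half {B : Matrix ι ι ℝ} {q : ι → ℝ} (h : IsErgodic B q) :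
    ∃ m > 0, ∀ k, ∑ l, |(deviation B q ^ m) l k| ≤ 1 / 2 := by
  obtain ⟨l₀, hl₀⟩ := h.reach
  have : Nonempty ι := ⟨l₀⟩
  -- There are finitely many agents, so one exponent `m` serves all of them and row `l₀` of `B ^ m`
  -- is bounded below by its minimum `δ > 0`.
  obtain ⟨m, hm, hm0⟩ := ((eventually_all.2 hl₀).and (eventually_gt_atTop 0)).exists
  obtain ⟨k₀, hk₀⟩ := Finite.exists_min fun k => (B ^ m) l₀ k
  set δ := (B ^ m) l₀ k₀
  have hPm : B ^ m ∈ colStochastic ℝ ι := pow_mem h.stochastic m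
  have hδ1 : δ ≤ 1 := le_one_of_mem_colStochastic hPm
  obtain ⟨n, hn⟩ := exists_pow_lt_of_lt_one (show (0 : ℝ) < 1 / 4 by norm_num)
    (show 1 - δ < 1 by linarith [hm k₀])
  have hδ0 : 0 < δ := hm k₀
  have hle : (1 - δ) ^ (n + 1) ≤ 1 / 4 := by
    rw [pow_succ]
    have := pow_nonneg (sub_nonneg.2 hδ1) n
    nlinarith
  refine ⟨m * (n + 1), by positivity, fun k => ?_⟩
  -- Column `k` of a positive power of the deviation is that power of `B` applied to `e_k - q`, a
  -- vector with sum zero and `ℓ¹` norm at most `2`. This is why the factor `1 / 4` is needed to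
  -- reach `1 / 2`.
  set y : ι → ℝ := Pi.single k 1 - q
  have hy : ∑ j, y j = 0 := by
    simp [y, h.sum_eq_one]
  have hya : ∑ j, |y j| ≤ 2 := by
    calc ∑ j, |y j| ≤ ∑ j, (|(Pi.single k 1 : ι → ℝ) j| + |q j|) :=
          Finset.sum_le_sum fun j _ => abs_sub _ _
      _ = ∑ j, ((Pi.single k 1 : ι → ℝ) j + q j) := by
          refine Finset.sum_congr rfl fun j _ => ?_
          rw [abs_of_nonneg (h.nonneg j), abs_of_nonneg]
          by_cases hjk : j = k
          · subst hjk; simp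
          · simp [hjk]
      _ = 2 := by
          rw [Finset.sum_add_distrib, h.sum_eq_one]
          simp; norm_num
  have hfix : ∀ j : ℕ, (B ^ j) *ᵥ q = q := by
    intro j
    induction j with
    | zero => simp
    | succ j ih => rw [pow_succ, ← Matrix.mulVec_mulVec, h.eigen, ih]
  have hcol : ∀ l, (deviation B q ^ (m * (n + 1))) l k = (((B ^ m) ^ (n + 1)) *ᵥ y) l := by
    intro l
    obtain ⟨r, hr⟩ : ∃ r, m * (n + 1) = r + 1 := ⟨m * (n + 1) - 1, by
      have : 0 < m * (n + 1) := by positivity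
      omega⟩
    rw [← pow_mul, hr, deviation_pow h.stochastic h.eigen h.sum_eq_one, Matrix.mulVec_sub, hfix]
    simp [deviation]
  simp only [hcol]
  calc _ ≤ (1 - δ) ^ (n + 1) * ∑ j, |y j| := sum_abs_pow_mulVec_le hPm hk₀ hy _
    _ ≤ 1 / 4 * 2 := by
        refine mul_le_mul hle hya (Finset.sum_nonneg fun _ _ => abs_nonneg _) (by norm_num)
    _ = 1 / 2 := by norm_num

lemma exists_isContractedBy_of_pow_le_half {D : Matrix ι ι ℝ} {m : ℕ} (hm : 0 < m)
    (hD : ∀ k, ∑ l, |(D ^ m) l k| ≤ 1 / 2) :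
    ∃ ρ : ℝ, 0 < ρ ∧ ρ < 1 ∧ ∃ Γ : ℝ, 0 ≤ Γ ∧
      ∀ (E : Type) [NormedAddCommGroup E] [NormedSpace ℝ E],
        ∃ W : (ι → E) → ℝ, IsContractedBy D ρ Γ W := by
  have hm' : (1 : ℝ) ≤ m := by exact_mod_cast hm
  -- Bernoulli's inequality gives `ρ ^ m ≥ 1 / 2` for this choice. Both `ρ` and `Γ` are fixed before
  -- the space `E`, so they depend on the matrix only.
  set ρ : ℝ := 1 - 1 / (2 * m)
  have hm2 : 1 / (2 * (m : ℝ)) ≤ 1 / 2 := by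
    rw [div_le_div_iff₀ (by positivity) (by norm_num)]; linarith
  have hρ0 : 0 < ρ := by simp only [ρ]; linarith
  have hρ1 : ρ < 1 := by
    have : 0 < 1 / (2 * (m : ℝ)) := by positivity
    simp only [ρ]; linarith
  have hρm : 1 / 2 ≤ ρ ^ m := by
    have := one_add_mul_le_pow (a := -(1 / (2 * (m : ℝ)))) (by linarith) m
    calc (1 / 2 : ℝ) = 1 + m * -(1 / (2 * (m : ℝ))) := by field_simp; norm_num
      _ ≤ _ := this
  set c : ℕ → ℝ := fun j => ∑ k, ∑ l, |(D ^ j) l k|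
  have hc0 : ∀ j, 0 ≤ c j := fun j =>
    Finset.sum_nonneg fun _ _ => Finset.sum_nonneg fun _ _ => abs_nonneg _
  have hc : ∀ j k, ∑ l, |(D ^ j) l k| ≤ c j := fun j k =>
    Finset.single_le_sum (f := fun k => ∑ l, |(D ^ j) l k|)
      (fun _ _ => Finset.sum_nonneg fun _ _ => abs_nonneg _) (Finset.mem_univ k)
  refine ⟨ρ, hρ0, hρ1, ∑ j ∈ Finset.range m, (ρ⁻¹) ^ j * c j,
    Finset.sum_nonneg fun j _ => mul_nonneg (by positivity) (hc0 j), fun E _ _ => ?_⟩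
  -- The adapted gauge is the sum of `ρ⁻ʲ ‖Dʲ e‖` over `j < m`. Applying `D` shifts the index at the
  -- price of a factor `ρ`, and the new last term `ρ⁻ᵐ ‖Dᵐ e‖` is at most the dropped first term
  -- `‖e‖`.
  set f : ℕ → (ι → E) → ℝ := fun j e => (ρ⁻¹) ^ j * ‖mix (D ^ j) e‖
  have hf0 : ∀ j e, 0 ≤ f j e := fun j e => by positivity
  refine ⟨fun e => ∑ j ∈ Finset.range m, f j e, ?_, fun e => ?_, fun e => ?_, fun e e' => ?_,
    fun e => ?_⟩
  · simp only [f]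
    unfold mix
    fun_prop
  · have : f 0 e = ‖e‖ := by simp [f, mix_one]
    rw [← this]
    exact Finset.single_le_sum (f := fun j => f j e) (fun j _ => hf0 j e) (Finset.mem_range.2 hm)
  · rw [Finset.sum_mul]
    refine Finset.sum_le_sum fun j _ => ?_
    rw [mul_assoc]
    exact mul_le_mul_of_nonneg_left (norm_mix_le (hc0 j) (hc j) e) (by positivity)
  · rw [← Finset.sum_add_distrib]
    refine Finset.sum_le_sum fun j _ => ?_
    simp only [f, ← mul_add, mix_add]
    exact mul_le_mul_of_nonneg_left (norm_add_le _ _) (by positivity)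
  · have hstep : ∀ j, f j (mix D e) = ρ * f (j + 1) e := by
      intro j
      simp only [f, mix_mix, ← pow_succ', pow_succ (ρ⁻¹)]
      field_simp
    simp only [hstep, ← Finset.mul_sum]
    refine mul_le_mul_of_nonneg_left ?_ hρ0.le
    have hlast : f m e ≤ f 0 e := by
      have h₁ : ‖mix (D ^ m) e‖ ≤ 1 / 2 * ‖e‖ := norm_mix_le (by norm_num) hD e
      have h₂ : f 0 e = ‖e‖ := by simp [f, mix_one]
      rw [h₂]
      simp only [f, inv_pow]
      rw [inv_mul_le_iff₀ (by positivity)]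
      exact h₁.trans (mul_le_mul_of_nonneg_right hρm (norm_nonneg _))
    have := Finset.sum_range_succ (fun j => f j e) m
    rw [Finset.sum_range_succ'] at this
    linarith

end Chains

end CompetingNetworks

namespace CompetingNetworks

/-! ### Centroids and consensus errors under one averaging step. -/

section Errors

open Matrix

variable {ι : Type*} [Fintype ι]

/-- The weighted average `∑ k, q k • v k`. -/
noncomputable def centroid {E : Type*} [AddCommGroup E] [Module ℝ E] (q : ι → ℝ) (v : ι → E) : E :=
  ∑ k, q k • v k

/-- The deviations of the agents from their weighted average. -/
noncomputable def err {E : Type*} [AddCommGroup E] [Module ℝ E] (q : ι → ℝ) (v : ι → E) : ι → E :=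
  fun k => v k - centroid q v

section Algebra

variable {E : Type*} [AddCommGroup E] [Module ℝ E]

lemma centroid_sub (q : ι → ℝ) (v w : ι → E) : centroid q (v - w) = centroid q v - centroid q w := by
  simp [centroid, smul_sub]

lemma centroid_add (q : ι → ℝ) (v w : ι → E) : centroid q (v + w) = centroid q v + centroid q w := by
  simp [centroid, Finset.sum_add_distrib]

lemma centroid_smul (q : ι → ℝ) (c : ℝ) (v : ι → E) : centroid q (c • v) = c • centroid q v := by
  simp [centroid, Finset.smul_sum, smul_comm c]

variable {B : Matrix ι ι ℝ} {q : ι → ℝ}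

/-- Agents combine along columns, so the Perron weights are exactly those that averaging leaves
invariant. -/
lemma centroid_mix (hq : B *ᵥ q = q) (v : ι → E) : centroid q (mix B v) = centroid q v := by
  simp only [centroid, mix, Finset.smul_sum, smul_smul]
  rw [Finset.sum_comm]
  refine Finset.sum_congr rfl fun l _ => ?_
  rw [← Finset.sum_smul]
  congr 1
  conv_rhs => rw [← hq]
  exact Finset.sum_congr rfl fun k _ => mul_comm _ _

/-- The columns of the deviation sum to zero, so it does not see a vector `c` common to all agents.
The freedom to choose `c` is what `IsContractedBy.err_step_le` uses. -/
lemma err_mix [DecidableEq ι] (hB : B ∈ colStochastic ℝ ι) (hq : B *ᵥ q = q) (hq₁ : ∑ k, q k = 1) (v : ι → E)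
    (c : E) : err q (mix B v) = mix (deviation B q) (v - fun _ => c) := by
  funext k
  simp only [err, centroid_mix hq]
  simp only [mix, deviation, Matrix.of_apply, Pi.sub_apply, smul_sub, sub_smul,
    Finset.sum_sub_distrib, ← Finset.sum_smul, sum_col_of_mem_colStochastic hB, hq₁]
  simp [centroid]

end Algebra

lemma norm_centroid_le {E : Type*} [NormedAddCommGroup E] [NormedSpace ℝ E] {q : ι → ℝ}
    (hq : ∀ k, 0 ≤ q k) (hq₁ : ∑ k, q k = 1) {v : ι → E} {c : ℝ} (hv : ∀ k, ‖v k‖ ≤ c) :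
    ‖centroid q v‖ ≤ c := by
  calc ‖∑ k, q k • v k‖ ≤ ∑ k, q k * c := by
        refine (norm_sum_le _ _).trans (Finset.sum_le_sum fun k _ => ?_)
        rw [norm_smul, Real.norm_of_nonneg (hq k)]
        exact mul_le_mul_of_nonneg_left (hv k) (hq k)
    _ = c := by rw [← Finset.sum_mul, hq₁, one_mul]

/-- One adapt-then-combine step contracts the consensus error up to the disagreement of the search
directions `f` with any common direction `ḡ`. -/
lemma IsContractedBy.err_step_le [DecidableEq ι] {E : Type*} [NormedAddCommGroup E]
    [NormedSpace ℝ E] {B : Matrix ι ι ℝ} {q : ι → ℝ} {ρ Γ μ : ℝ} {W : (ι → E) → ℝ}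
    (hW : IsContractedBy (deviation B q) ρ Γ W) (hB : IsErgodic B q) (hρ : 0 ≤ ρ) (hρ₁ : ρ ≤ 1)
    (hΓ : 0 ≤ Γ) (hμ : 0 ≤ μ) (x f : ι → E) (g : E) {c : ℝ} (hc : 0 ≤ c)
    (hf : ∀ k, ‖f k - g‖ ≤ c) :
    W (err q (mix B (x - μ • f))) ≤ ρ * W (err q x) + μ * (Γ * c) := by
  have h₁ : err q (mix B (x - μ • f)) =
      mix (deviation B q) (err q x + -(μ • fun k => f k - g)) := by
    -- The common vector removes both the centroid and the common part of the search directions,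
    -- leaving only their disagreement.
    rw [err_mix hB.stochastic hB.eigen hB.sum_eq_one _ (centroid q x - μ • g)]
    congr 1
    funext k
    simp only [err, Pi.sub_apply, Pi.add_apply, Pi.smul_apply, Pi.neg_apply, smul_sub]
    abel
  have h₂ : W (-(μ • fun k => f k - g)) ≤ μ * (Γ * c) := by
    refine (hW.le_norm _).trans ?_
    rw [norm_neg, norm_smul, Real.norm_of_nonneg hμ]
    have : ‖fun k => f k - g‖ ≤ c := (pi_norm_le_iff_of_nonneg hc).2 hf
    calc Γ * (μ * ‖fun k => f k - g‖) ≤ Γ * (μ * c) := by gcongr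
      _ = _ := by ring
  have h₃ : 0 ≤ W (-(μ • fun k => f k - g)) := (norm_nonneg _).trans (hW.norm_le _)
  rw [h₁]
  calc _ ≤ ρ * W (err q x + -(μ • fun k => f k - g)) := hW.mix_le _
    _ ≤ ρ * (W (err q x) + W (-(μ • fun k => f k - g))) :=
        mul_le_mul_of_nonneg_left (hW.add_le _ _) hρ
    _ ≤ ρ * W (err q x) + μ * (Γ * c) := by
        rw [mul_add]
        have := mul_le_mul_of_nonneg_right hρ₁ h₃
        linarith

end Errors

/-! ### Lipschitz gradient fields and their averages. -/

section Fields

variable {ι : Type*} [Fintype ι] {M₁ M₂ : ℕ}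

/-- The weighted average of the gradient fields. -/
noncomputable def meanField {E : Type*} [AddCommGroup E] [Module ℝ E] (q : ι → ℝ)
    (g : ι → Strat M₁ → Strat M₂ → E) (x : Strat M₁) (y : Strat M₂) : E :=
  centroid q fun k => g k x y

/-- The gradient fields that the agents sample for the first (`gx`) and second (`gy`) strategy are
Lipschitz and agree with their averages up to `G`. -/
structure FieldBounds (qx qy : ι → ℝ) (gx : ι → Strat M₁ → Strat M₂ → Strat M₁)
    (gy : ι → Strat M₁ → Strat M₂ → Strat M₂) (L G : ℝ) : Prop where
  L_nonneg : 0 ≤ L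
  G_nonneg : 0 ≤ G
  lip_x : ∀ k, LipschitzField L (gx k)
  lip_y : ∀ k, LipschitzField L (gy k)
  gap_x : ∀ k, BoundedDisagreement G (gx k) (meanField qx gx)
  gap_y : ∀ k, BoundedDisagreement G (gy k) (meanField qy gy)

lemma LipschitzField.continuous {E : Type*} [NormedAddCommGroup E] {L : ℝ}
    {g : Strat M₁ → Strat M₂ → E} (hg : LipschitzField L g) :
    Continuous fun z : Strat M₁ × Strat M₂ => g z.1 z.2 := by
  refine (LipschitzWith.of_dist_le_mul (K := 2 * Real.toNNReal L) fun z w => ?_).continuous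
  have h₁ : ‖z.1 - w.1‖ ≤ dist z w := (dist_eq_norm z.1 w.1).symm.le.trans (le_max_left _ _)
  have h₂ : ‖z.2 - w.2‖ ≤ dist z w := (dist_eq_norm z.2 w.2).symm.le.trans (le_max_right _ _)
  rw [dist_eq_norm, NNReal.coe_mul, NNReal.coe_ofNat]
  calc _ ≤ L * (‖z.1 - w.1‖ + ‖z.2 - w.2‖) := hg _ _ _ _
    _ ≤ Real.toNNReal L * (dist z w + dist z w) :=
        mul_le_mul (Real.le_coe_toNNReal L) (add_le_add h₁ h₂) (by positivity) (by positivity)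
    _ = _ := by ring

/-- A Lipschitz field grows at most linearly, and constants are square integrable under a
probability measure. -/
lemma LipschitzField.memLp {E Ω : Type*} [NormedAddCommGroup E] [MeasurableSpace Ω]
    {P : Measure Ω} [IsProbabilityMeasure P] {L : ℝ} (hL : 0 ≤ L)
    {g : Strat M₁ → Strat M₂ → E} (hg : LipschitzField L g) {x : Ω → Strat M₁} {y : Ω → Strat M₂}
    (hx : MemLp x 2 P) (hy : MemLp y 2 P) : MemLp (fun ω => g (x ω) (y ω)) 2 P := by
  have hb : MemLp (fun ω => ‖g 0 0‖ + L * (‖x ω‖ + ‖y ω‖)) 2 P :=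
    (memLp_const (‖g 0 0‖ : ℝ)).add ((hx.norm.add hy.norm).const_mul L)
  refine hb.of_le (hg.continuous.comp_aestronglyMeasurable (hx.1.prodMk hy.1))
    (ae_of_all _ fun ω => ?_)
  have h₁ := hg (x ω) 0 (y ω) 0
  have h₂ := norm_sub_norm_le (g (x ω) (y ω)) (g 0 0)
  rw [sub_zero, sub_zero] at h₁
  rw [Real.norm_of_nonneg (by positivity)]
  linarith

/-- A common direction for all agents: the average field at the centroids. Every noisy search
direction agrees with it up to the consensus errors, the gradient gap and the noise. -/
lemma norm_field_add_noise_sub_le {E : Type*} [NormedAddCommGroup E] [NormedSpace ℝ E] {L G : ℝ}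
    (hL : 0 ≤ L) {g : ι → Strat M₁ → Strat M₂ → E} {q : ι → ℝ}
    (hg : ∀ k, LipschitzField L (g k)) (hG : ∀ k, BoundedDisagreement G (g k) (meanField q g))
    {x : ι → Strat M₁} {y : ι → Strat M₂} {n : ι → E} {cx : Strat M₁} {cy : Strat M₂} {V N : ℝ}
    (hV : ∀ k, ‖x k - cx‖ + ‖y k - cy‖ ≤ V) (hN : ∀ k, ‖n k‖ ≤ N) (k : ι) :
    ‖g k (x k) (y k) + n k - meanField q g cx cy‖ ≤ L * V + G + N := by
  have h₁ := hg k (x k) cx (y k) cy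
  have h₂ := hG k cx cy
  have h₃ := hN k
  have h₄ := mul_le_mul_of_nonneg_left (hV k) hL
  calc ‖g k (x k) (y k) + n k - meanField q g cx cy‖
      = ‖(g k (x k) (y k) - g k cx cy) + (g k cx cy - meanField q g cx cy) + n k‖ := by
        congr 1; abel
    _ ≤ _ := norm_add₃_le
    _ ≤ _ := by linarith

end Fields

/-! ### Abstract coupled chains: integrability, noise size, a contractive recursion. -/

section Run

variable {ι : Type*} [Fintype ι] {M₁ M₂ : ℕ} {Ω : Type*} [MeasurableSpace Ω]

/-- Two coupled averaging chains: each agent combines, with the weights `Bx` and `By`, the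
strategies of all agents after a step along their gradients, with square-integrable noise. -/
structure IsChain (Bx By : Matrix ι ι ℝ) (gx : ι → Strat M₁ → Strat M₂ → Strat M₁)
    (gy : ι → Strat M₁ → Strat M₂ → Strat M₂) (μ : ℝ) (P : Measure Ω)
    (x : ℕ → Ω → ι → Strat M₁) (y : ℕ → Ω → ι → Strat M₂)
    (nx : ℕ → Ω → ι → Strat M₁) (ny : ℕ → Ω → ι → Strat M₂) : Prop where
  x_zero : ∀ ω, x 0 ω = 0
  y_zero : ∀ ω, y 0 ω = 0
  x_succ : ∀ i ω, x (i + 1) ω =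
    mix Bx (x i ω - μ • fun k => gx k (x i ω k) (y i ω k) + nx i ω k)
  y_succ : ∀ i ω, y (i + 1) ω =
    mix By (y i ω - μ • fun k => gy k (x i ω k) (y i ω k) + ny i ω k)
  memLp_nx : ∀ i k, MemLp (fun ω => nx i ω k) 2 P
  memLp_ny : ∀ i k, MemLp (fun ω => ny i ω k) 2 P

/-- Coupled averaging chains whose noise has variance at most `σ²` and is orthogonal to every
function of the current iterates. -/
structure IsRun (Bx By : Matrix ι ι ℝ) (gx : ι → Strat M₁ → Strat M₂ → Strat M₁)
    (gy : ι → Strat M₁ → Strat M₂ → Strat M₂) (μ σ : ℝ) (P : Measure Ω)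
    (x : ℕ → Ω → ι → Strat M₁) (y : ℕ → Ω → ι → Strat M₂)
    (nx : ℕ → Ω → ι → Strat M₁) (ny : ℕ → Ω → ι → Strat M₂) : Prop
    extends IsChain Bx By gx gy μ P x y nx ny where
  nx_le : ∀ i k, ∫ ω, ‖nx i ω k‖ ^ 2 ∂P ≤ σ ^ 2
  ny_le : ∀ i k, ∫ ω, ‖ny i ω k‖ ^ 2 ∂P ≤ σ ^ 2
  nx_orth : ∀ i k (h : (ι → Strat M₁) × (ι → Strat M₂) → Strat M₁), Continuous h →
    MemLp (fun ω => h (x i ω, y i ω)) 2 P → ∫ ω, inner ℝ (h (x i ω, y i ω)) (nx i ω k) ∂P = 0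
  ny_orth : ∀ i k (h : (ι → Strat M₁) × (ι → Strat M₂) → Strat M₂), Continuous h →
    MemLp (fun ω => h (x i ω, y i ω)) 2 P → ∫ ω, inner ℝ (h (x i ω, y i ω)) (ny i ω k) ∂P = 0

lemma memLp_centroid {E : Type*} [NormedAddCommGroup E] [NormedSpace ℝ E] {P : Measure Ω}
    (q : ι → ℝ) {v : Ω → ι → E} (hv : ∀ k, MemLp (fun ω => v ω k) 2 P) :
    MemLp (fun ω => centroid q (v ω)) 2 P :=
  memLp_finsetSum _ fun k _ => (hv k).const_smul (q k)

variable {Bx By : Matrix ι ι ℝ} {qx qy : ι → ℝ} {gx : ι → Strat M₁ → Strat M₂ → Strat M₁}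
  {gy : ι → Strat M₁ → Strat M₂ → Strat M₂} {L G μ σ : ℝ} {P : Measure Ω}
  {x : ℕ → Ω → ι → Strat M₁} {y : ℕ → Ω → ι → Strat M₂}
  {nx : ℕ → Ω → ι → Strat M₁} {ny : ℕ → Ω → ι → Strat M₂}

lemma IsChain.memLp [IsProbabilityMeasure P] (h : IsChain Bx By gx gy μ P x y nx ny) (hg : FieldBounds qx qy gx gy L G) (i : ℕ) :
    (∀ k, MemLp (fun ω => x i ω k) 2 P) ∧ ∀ k, MemLp (fun ω => y i ω k) 2 P := by
  induction i with
  | zero => simp [h.x_zero, h.y_zero]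
  | succ i ih =>
    refine ⟨fun k => ?_, fun k => ?_⟩
    · simp only [h.x_succ]
      exact memLp_finsetSum _ fun l _ => ((ih.1 l).sub ((((hg.lip_x l).memLp hg.L_nonneg
        (ih.1 l) (ih.2 l)).add (h.memLp_nx i l)).const_smul μ)).const_smul (Bx l k)
    · simp only [h.y_succ]
      exact memLp_finsetSum _ fun l _ => ((ih.2 l).sub ((((hg.lip_y l).memLp hg.L_nonneg
        (ih.1 l) (ih.2 l)).add (h.memLp_ny i l)).const_smul μ)).const_smul (By l k)

/-- The total size of the gradient noise in one iteration. -/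
noncomputable def noiseSize (nx : ι → Strat M₁) (ny : ι → Strat M₂) : ℝ :=
  ∑ k, ‖nx k‖ + ∑ k, ‖ny k‖

lemma noiseSize_nonneg (nx : ι → Strat M₁) (ny : ι → Strat M₂) : 0 ≤ noiseSize nx ny := by
  unfold noiseSize; positivity

lemma norm_le_noiseSize_left (nx : ι → Strat M₁) (ny : ι → Strat M₂) (k : ι) :
    ‖nx k‖ ≤ noiseSize nx ny := by
  have h₁ := Finset.single_le_sum (f := fun k => ‖nx k‖) (fun _ _ => norm_nonneg _)
    (Finset.mem_univ k)
  have h₂ : 0 ≤ ∑ k, ‖ny k‖ := by positivity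
  unfold noiseSize
  linarith

lemma norm_le_noiseSize_right (nx : ι → Strat M₁) (ny : ι → Strat M₂) (k : ι) :
    ‖ny k‖ ≤ noiseSize nx ny := by
  have h₁ := Finset.single_le_sum (f := fun k => ‖ny k‖) (fun _ _ => norm_nonneg _)
    (Finset.mem_univ k)
  have h₂ : 0 ≤ ∑ k, ‖nx k‖ := by positivity
  unfold noiseSize
  linarith

lemma IsRun.memLp_noiseSize (h : IsRun Bx By gx gy μ σ P x y nx ny) (i : ℕ) :
    MemLp (fun ω => noiseSize (nx i ω) (ny i ω)) 2 P :=
  (memLp_finsetSum _ fun k _ => (h.memLp_nx i k).norm).add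
    (memLp_finsetSum _ fun k _ => (h.memLp_ny i k).norm)

lemma IsRun.integral_noiseSize_sq_le (h : IsRun Bx By gx gy μ σ P x y nx ny) (i : ℕ) :
    ∫ ω, noiseSize (nx i ω) (ny i ω) ^ 2 ∂P ≤ 4 * Fintype.card ι ^ 2 * σ ^ 2 := by
  have hx := fun k => (h.memLp_nx i k).norm.integrable_sq
  have hy := fun k => (h.memLp_ny i k).norm.integrable_sq
  have hsx := integrable_finsetSum Finset.univ fun k _ => hx k
  have hsy := integrable_finsetSum Finset.univ fun k _ => hy k
  calc ∫ ω, noiseSize (nx i ω) (ny i ω) ^ 2 ∂P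
      ≤ ∫ ω, 2 * Fintype.card ι * (∑ k, ‖nx i ω k‖ ^ 2 + ∑ k, ‖ny i ω k‖ ^ 2) ∂P := by
        refine integral_mono (h.memLp_noiseSize i).integrable_sq ((hsx.add hsy).const_mul _)
          fun ω => ?_
        have h₁ := sq_sum_le_card_mul_sum_sq (s := Finset.univ) (f := fun k => ‖nx i ω k‖)
        have h₂ := sq_sum_le_card_mul_sum_sq (s := Finset.univ) (f := fun k => ‖ny i ω k‖)
        rw [Finset.card_univ] at h₁ h₂
        have h₃ := add_sq_le (a := ∑ k, ‖nx i ω k‖) (b := ∑ k, ‖ny i ω k‖)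
        simp only [noiseSize]
        linarith
    _ = 2 * Fintype.card ι * (∑ k, ∫ ω, ‖nx i ω k‖ ^ 2 ∂P + ∑ k, ∫ ω, ‖ny i ω k‖ ^ 2 ∂P) := by
        rw [integral_const_mul, integral_add hsx hsy, integral_finsetSum _ fun k _ => hx k,
          integral_finsetSum _ fun k _ => hy k]
    _ ≤ 2 * Fintype.card ι * (∑ _k : ι, σ ^ 2 + ∑ _k : ι, σ ^ 2) := by
        gcongr with k _ k _
        · exact h.nx_le i k
        · exact h.ny_le i k
    _ = _ := by
        simp only [Finset.sum_const, Finset.card_univ, nsmul_eq_mul]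
        ring

/-- A nonnegative process with a contractive recursion driven by a square-integrable input stays
proportional to the step size in mean square. -/
lemma integral_sq_le_of_contractive {ρ μ β : ℝ} (hρ : 0 ≤ ρ) (hρ₁ : ρ < 1)
    {V b : ℕ → Ω → ℝ} (hV : ∀ i, MemLp (V i) 2 P) (hb : ∀ i, MemLp (b i) 2 P)
    (hV₀ : ∀ i ω, 0 ≤ V i ω) (hβ : 0 ≤ β)
    (hbβ : ∀ i, ∫ ω, b i ω ^ 2 ∂P ≤ β)
    (hzero : ∀ ω, V 0 ω = 0) (hstep : ∀ i ω, V (i + 1) ω ≤ ρ * V i ω + μ * b i ω) (i : ℕ) :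
    ∫ ω, V i ω ^ 2 ∂P ≤ μ ^ 2 * (β / (1 - ρ) ^ 2) := by
  have h1 : 0 < 1 - ρ := by linarith
  induction i with
  | zero =>
    simp only [hzero]
    simp only [ne_eq, OfNat.ofNat_ne_zero, not_false_eq_true, zero_pow, integral_zero]
    positivity
  | succ i ih =>
    -- Convexity of the square, with weights `ρ` and `1 - ρ` on `V` and `μ b / (1 - ρ)`. The claimed
    -- bound is the fixed point of the resulting recursion.
    have hpt : ∀ ω, V (i + 1) ω ^ 2 ≤ ρ * V i ω ^ 2 + μ ^ 2 / (1 - ρ) * b i ω ^ 2 := by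
      intro ω
      have h₁ : V (i + 1) ω ^ 2 ≤ (ρ * V i ω + μ * b i ω) ^ 2 :=
        pow_le_pow_left₀ (hV₀ _ _) (hstep i ω) 2
      refine h₁.trans (sub_nonneg.1 ?_)
      have : ρ * V i ω ^ 2 + μ ^ 2 / (1 - ρ) * b i ω ^ 2 - (ρ * V i ω + μ * b i ω) ^ 2 =
          ρ / (1 - ρ) * ((1 - ρ) * V i ω - μ * b i ω) ^ 2 := by
        field_simp
        ring
      rw [this]
      positivity
    have hVi := (hV i).integrable_sq
    have hbi := (hb i).integrable_sq
    calc ∫ ω, V (i + 1) ω ^ 2 ∂P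
        ≤ ∫ ω, (ρ * V i ω ^ 2 + μ ^ 2 / (1 - ρ) * b i ω ^ 2) ∂P :=
          integral_mono (hV _).integrable_sq ((hVi.const_mul _).add (hbi.const_mul _)) hpt
      _ = ρ * ∫ ω, V i ω ^ 2 ∂P + μ ^ 2 / (1 - ρ) * ∫ ω, b i ω ^ 2 ∂P := by
          rw [integral_add (hVi.const_mul _) (hbi.const_mul _), integral_const_mul,
            integral_const_mul]
      _ ≤ ρ * (μ ^ 2 * (β / (1 - ρ) ^ 2)) + μ ^ 2 / (1 - ρ) * β := by
          gcongr
          exact hbβ i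
      _ = μ ^ 2 * (β / (1 - ρ) ^ 2) := by
          field_simp
          ring

end Run

end CompetingNetworks

namespace CompetingNetworks

/-! ### Mean-square consensus and the recursion of the centroids. -/

section Run

variable {ι : Type*} [Fintype ι] {M₁ M₂ : ℕ} {Ω : Type*} [MeasurableSpace Ω]
  {Bx By : Matrix ι ι ℝ} {qx qy : ι → ℝ} {gx : ι → Strat M₁ → Strat M₂ → Strat M₁}
  {gy : ι → Strat M₁ → Strat M₂ → Strat M₂} {L G μ σ : ℝ} {P : Measure Ω}
  {x : ℕ → Ω → ι → Strat M₁} {y : ℕ → Ω → ι → Strat M₂}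
  {nx : ℕ → Ω → ι → Strat M₁} {ny : ℕ → Ω → ι → Strat M₂}

lemma integrable_inner_of_memLp {E : Type*} [NormedAddCommGroup E] [InnerProductSpace ℝ E]
    {f g : Ω → E} (hf : MemLp f 2 P) (hg : MemLp g 2 P) :
    Integrable (fun ω => inner ℝ (f ω) (g ω)) P := by
  have h : Integrable (fun ω => ‖f ω‖ * ‖g ω‖) P := hf.norm.integrable_mul hg.norm
  exact h.mono' (hf.1.inner hg.1) (ae_of_all _ fun ω => norm_inner_le_norm _ _)

lemma integrable_norm_sq_of_memLp {E : Type*} [NormedAddCommGroup E] {f : Ω → E}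
    (hf : MemLp f 2 P) : Integrable (fun ω => ‖f ω‖ ^ 2) P :=
  hf.norm.integrable_sq

/-- The size of the consensus errors of both chains, in norms adapted to the chains. -/
noncomputable def errSize (Wx : (ι → Strat M₁) → ℝ) (Wy : (ι → Strat M₂) → ℝ) (qx qy : ι → ℝ)
    (x : ι → Strat M₁) (y : ι → Strat M₂) : ℝ :=
  Wx (err qx x) + Wy (err qy y)

/-- The constant in the mean-square consensus bound. -/
noncomputable def consensusConst (n : ℕ) (α Γ G σ : ℝ) : ℝ :=
  8 * Γ ^ 2 * (G ^ 2 + 4 * n ^ 2 * σ ^ 2) / (1 - (1 + α) / 2) ^ 2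

lemma consensusConst_nonneg (n : ℕ) (α Γ G σ : ℝ) : 0 ≤ consensusConst n α Γ G σ := by
  unfold consensusConst; positivity

section Lyapunov

variable [IsProbabilityMeasure P] {α Γ : ℝ} {Wx : (ι → Strat M₁) → ℝ}
  {Wy : (ι → Strat M₂) → ℝ}

lemma norm_err_add_le_errSize (hWx : IsContractedBy (deviation Bx qx) α Γ Wx)
    (hWy : IsContractedBy (deviation By qy) α Γ Wy) (x : ι → Strat M₁) (y : ι → Strat M₂) :
    ‖err qx x‖ + ‖err qy y‖ ≤ errSize Wx Wy qx qy x y :=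
  add_le_add (hWx.norm_le _) (hWy.norm_le _)

lemma errSize_nonneg (hWx : IsContractedBy (deviation Bx qx) α Γ Wx)
    (hWy : IsContractedBy (deviation By qy) α Γ Wy) (x : ι → Strat M₁) (y : ι → Strat M₂) :
    0 ≤ errSize Wx Wy qx qy x y :=
  (by positivity : (0 : ℝ) ≤ ‖err qx x‖ + ‖err qy y‖).trans (norm_err_add_le_errSize hWx hWy x y)

lemma norm_dev_add_le_errSize (hWx : IsContractedBy (deviation Bx qx) α Γ Wx)
    (hWy : IsContractedBy (deviation By qy) α Γ Wy) (x : ι → Strat M₁) (y : ι → Strat M₂) (k : ι) :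
    ‖x k - centroid qx x‖ + ‖y k - centroid qy y‖ ≤ errSize Wx Wy qx qy x y :=
  (add_le_add (norm_le_pi_norm (err qx x) k) (norm_le_pi_norm (err qy y) k)).trans
    (norm_err_add_le_errSize hWx hWy x y)

lemma IsRun.memLp_errSize (h : IsRun Bx By gx gy μ σ P x y nx ny)
    (hg : FieldBounds qx qy gx gy L G) (hWx : IsContractedBy (deviation Bx qx) α Γ Wx)
    (hWy : IsContractedBy (deviation By qy) α Γ Wy) (i : ℕ) :
    MemLp (fun ω => errSize Wx Wy qx qy (x i ω) (y i ω)) 2 P := by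
  have key : ∀ {E : Type} [NormedAddCommGroup E] [NormedSpace ℝ E] {D : Matrix ι ι ℝ}
      {W : (ι → E) → ℝ} (q : ι → ℝ) (v : Ω → ι → E), IsContractedBy D α Γ W →
      (∀ k, MemLp (fun ω => v ω k) 2 P) → MemLp (fun ω => W (err q (v ω))) 2 P := by
    intro E _ _ D W q v hW hv
    have he : MemLp (fun ω => err q (v ω)) 2 P :=
      memLp_pi_iff.2 fun k => (hv k).sub (memLp_centroid q hv)
    refine (he.norm.const_mul Γ).of_le (hW.continuous.comp_aestronglyMeasurable he.1)
      (ae_of_all _ fun ω => ?_)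
    have h₀ : 0 ≤ W (err q (v ω)) := (norm_nonneg _).trans (hW.norm_le _)
    rw [Real.norm_of_nonneg h₀]
    exact (hW.le_norm _).trans (le_abs_self _)
  have hm := h.memLp hg i
  exact (key qx _ hWx hm.1).add (key qy _ hWy hm.2)

/-- Mean-square consensus of the two coupled chains. -/
theorem IsRun.integral_errSize_sq_le [DecidableEq ι] (h : IsRun Bx By gx gy μ σ P x y nx ny)
    (hg : FieldBounds qx qy gx gy L G) (hBx : IsErgodic Bx qx) (hBy : IsErgodic By qy)
    (hWx : IsContractedBy (deviation Bx qx) α Γ Wx)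
    (hWy : IsContractedBy (deviation By qy) α Γ Wy) (hα : 0 < α) (hα₁ : α < 1) (hΓ : 0 ≤ Γ)
    (hμ : 0 ≤ μ) (hμs : μ * (2 * Γ * L) ≤ (1 - α) / 2) (i : ℕ) :
    ∫ ω, errSize Wx Wy qx qy (x i ω) (y i ω) ^ 2 ∂P ≤
      μ ^ 2 * consensusConst (Fintype.card ι) α Γ G σ := by
  have hG := hg.G_nonneg
  have hL := hg.L_nonneg
  have hb : ∀ j, MemLp (fun ω => 2 * Γ * (G + noiseSize (nx j ω) (ny j ω))) 2 P := fun j =>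
    ((memLp_const (G : ℝ)).add (h.memLp_noiseSize j)).const_mul _
  -- The factor `(1 + α) / 2` is `α` plus the slack `(1 - α) / 2` that the step-size condition
  -- leaves for the Lipschitz feedback. The `2` in the input `2 Γ (G + N)` counts the two chains.
  refine integral_sq_le_of_contractive (ρ := (1 + α) / 2) (by linarith) (by linarith)
    (b := fun j ω => 2 * Γ * (G + noiseSize (nx j ω) (ny j ω)))
    (V := fun j ω => errSize Wx Wy qx qy (x j ω) (y j ω)) (h.memLp_errSize hg hWx hWy) hb
    (fun j ω => errSize_nonneg hWx hWy _ _) (by positivity) (fun j => ?_) (fun ω => ?_)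
    (fun j ω => ?_) i
  · have hN := (h.memLp_noiseSize j).integrable_sq
    calc ∫ ω, (2 * Γ * (G + noiseSize (nx j ω) (ny j ω))) ^ 2 ∂P
        ≤ ∫ ω, 8 * Γ ^ 2 * (G ^ 2 + noiseSize (nx j ω) (ny j ω) ^ 2) ∂P := by
          refine integral_mono (hb j).integrable_sq
            (((integrable_const _).add hN).const_mul _) fun ω => ?_
          have h₁ := add_sq_le (a := G) (b := noiseSize (nx j ω) (ny j ω))
          have h₂ := mul_le_mul_of_nonneg_left h₁ (by positivity : 0 ≤ 4 * Γ ^ 2)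
          simp only
          linarith
      _ = 8 * Γ ^ 2 * (G ^ 2 + ∫ ω, noiseSize (nx j ω) (ny j ω) ^ 2 ∂P) := by
          rw [integral_const_mul, integral_add (integrable_const _) hN]
          simp
      _ ≤ _ := by
          gcongr
          exact h.integral_noiseSize_sq_le j
  · have hz : ∀ {E : Type} [NormedAddCommGroup E] [NormedSpace ℝ E] {D : Matrix ι ι ℝ}
        {W : (ι → E) → ℝ} (q : ι → ℝ), IsContractedBy D α Γ W → W (err q 0) = 0 := by
      intro E _ _ D W q hW
      have h₀ : err q (0 : ι → E) = 0 := by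
        funext k
        simp [err, centroid]
      rw [h₀]
      refine le_antisymm ?_ ((norm_nonneg _).trans (hW.norm_le _))
      simpa using hW.le_norm 0
    simp only [errSize, h.x_zero, h.y_zero, hz qx hWx, hz qy hWy, add_zero]
  · set V := errSize Wx Wy qx qy (x j ω) (y j ω)
    set N := noiseSize (nx j ω) (ny j ω)
    have hV0 : 0 ≤ V := errSize_nonneg hWx hWy _ _
    have hN0 : 0 ≤ N := noiseSize_nonneg _ _
    have hV := norm_dev_add_le_errSize hWx hWy (x j ω) (y j ω)
    have h₁ := hWx.err_step_le hBx hα.le hα₁.le hΓ hμ (x j ω)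
      (fun k => gx k (x j ω k) (y j ω k) + nx j ω k) _ (c := L * V + G + N) (by positivity)
      (norm_field_add_noise_sub_le hL hg.lip_x hg.gap_x hV (norm_le_noiseSize_left _ _))
    have h₂ := hWy.err_step_le hBy hα.le hα₁.le hΓ hμ (y j ω)
      (fun k => gy k (x j ω k) (y j ω k) + ny j ω k) _ (c := L * V + G + N) (by positivity)
      (norm_field_add_noise_sub_le hL hg.lip_y hg.gap_y hV (norm_le_noiseSize_right _ _))
    rw [← h.x_succ] at h₁
    rw [← h.y_succ] at h₂
    -- Each chain feeds back `μ Γ L V`, since gradients are sampled at points that involve both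
    -- errors. Only the sum of the two errors closes the recursion.
    have h₃ := mul_le_mul_of_nonneg_right hμs hV0
    have h₄ : V = Wx (err qx (x j ω)) + Wy (err qy (y j ω)) := rfl
    have h₅ : α * V = α * Wx (err qx (x j ω)) + α * Wy (err qy (y j ω)) := by rw [h₄, mul_add]
    simp only [errSize]
    linarith

end Lyapunov

/-! ### The centroids -/

/-- The pair of centroids. -/
noncomputable def jointCentroid (qx qy : ι → ℝ) (x : ι → Strat M₁) (y : ι → Strat M₂) :
    JointStrat M₁ M₂ :=
  WithLp.toLp 2 (centroid qx x, centroid qy y)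

/-- The pair of average gradient fields. -/
noncomputable def jointField (qx qy : ι → ℝ) (gx : ι → Strat M₁ → Strat M₂ → Strat M₁)
    (gy : ι → Strat M₁ → Strat M₂ → Strat M₂) (z : JointStrat M₁ M₂) : JointStrat M₁ M₂ :=
  WithLp.toLp 2 (meanField qx gx z.fst z.snd, meanField qy gy z.fst z.snd)

/-- The gradients that the agents evaluate, averaged. -/
noncomputable def sampledField (qx qy : ι → ℝ) (gx : ι → Strat M₁ → Strat M₂ → Strat M₁)
    (gy : ι → Strat M₁ → Strat M₂ → Strat M₂) (x : ι → Strat M₁) (y : ι → Strat M₂) :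
    JointStrat M₁ M₂ :=
  jointCentroid qx qy (fun k => gx k (x k) (y k)) fun k => gy k (x k) (y k)

lemma norm_toLp_le (a : Strat M₁) (b : Strat M₂) :
    ‖(WithLp.toLp 2 (a, b) : JointStrat M₁ M₂)‖ ≤ ‖a‖ + ‖b‖ := by
  rw [← abs_of_nonneg (norm_nonneg (WithLp.toLp 2 (a, b) : JointStrat M₁ M₂)),
    ← abs_of_nonneg (add_nonneg (norm_nonneg a) (norm_nonneg b)), ← sq_le_sq,
    WithLp.prod_norm_sq_eq_of_L2]
  have := mul_nonneg (norm_nonneg a) (norm_nonneg b)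
  change ‖a‖ ^ 2 + ‖b‖ ^ 2 ≤ _
  nlinarith

lemma memLp_jointCentroid {u : Ω → ι → Strat M₁} {v : Ω → ι → Strat M₂}
    (hu : ∀ k, MemLp (fun ω => u ω k) 2 P) (hv : ∀ k, MemLp (fun ω => v ω k) 2 P) :
    MemLp (fun ω => jointCentroid qx qy (u ω) (v ω)) 2 P :=
  memLp_prodLp_iff.2 ⟨memLp_centroid qx hu, memLp_centroid qy hv⟩

lemma IsRun.jointCentroid_succ (h : IsRun Bx By gx gy μ σ P x y nx ny)
    (hx : Bx.mulVec qx = qx) (hy : By.mulVec qy = qy) (i : ℕ) (ω : Ω) :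
    jointCentroid qx qy (x (i + 1) ω) (y (i + 1) ω) =
      jointCentroid qx qy (x i ω) (y i ω) - μ • (sampledField qx qy gx gy (x i ω) (y i ω) +
        jointCentroid qx qy (nx i ω) (ny i ω)) := by
  have hadd : ∀ {E : Type} [AddCommGroup E] [Module ℝ E] (q : ι → ℝ) (a b c : ι → E),
      centroid q (a - μ • fun k => b k + c k) =
        centroid q a - μ • (centroid q b + centroid q c) := by
    intro E _ _ q a b c
    rw [centroid_sub, centroid_smul, ← centroid_add]
    rfl
  simp only [jointCentroid, sampledField, h.x_succ, h.y_succ, centroid_mix hx, centroid_mix hy,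
    hadd]
  rfl

lemma norm_sampledField_sub_le (hg : FieldBounds qx qy gx gy L G) (hqx : ∀ k, 0 ≤ qx k)
    (hqx₁ : ∑ k, qx k = 1) (hqy : ∀ k, 0 ≤ qy k) (hqy₁ : ∑ k, qy k = 1) {u : ι → Strat M₁}
    {v : ι → Strat M₂} {V : ℝ} (hV : ∀ k, ‖u k - centroid qx u‖ + ‖v k - centroid qy v‖ ≤ V) :
    ‖sampledField qx qy gx gy u v - jointField qx qy gx gy (jointCentroid qx qy u v)‖ ≤
      2 * L * V := by
  have h₁ : ‖centroid qx ((fun k => gx k (u k) (v k)) -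
      fun k => gx k (centroid qx u) (centroid qy v))‖ ≤ L * V :=
    norm_centroid_le hqx hqx₁ fun k => (hg.lip_x k _ _ _ _).trans
      (mul_le_mul_of_nonneg_left (hV k) hg.L_nonneg)
  have h₂ : ‖centroid qy ((fun k => gy k (u k) (v k)) -
      fun k => gy k (centroid qx u) (centroid qy v))‖ ≤ L * V :=
    norm_centroid_le hqy hqy₁ fun k => (hg.lip_y k _ _ _ _).trans
      (mul_le_mul_of_nonneg_left (hV k) hg.L_nonneg)
  rw [centroid_sub] at h₁ h₂
  refine (norm_toLp_le _ _).trans ((add_le_add h₁ h₂).trans (le_of_eq (by ring)))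

lemma norm_jointCentroid_noise_le (hqx : ∀ k, 0 ≤ qx k) (hqx₁ : ∑ k, qx k = 1)
    (hqy : ∀ k, 0 ≤ qy k) (hqy₁ : ∑ k, qy k = 1) (u : ι → Strat M₁) (v : ι → Strat M₂) :
    ‖jointCentroid qx qy u v‖ ≤ 2 * noiseSize u v := by
  refine (norm_toLp_le _ _).trans ?_
  rw [two_mul]
  exact add_le_add (norm_centroid_le hqx hqx₁ (norm_le_noiseSize_left u v))
    (norm_centroid_le hqy hqy₁ (norm_le_noiseSize_right u v))

/-- One factor `2` comes from bounding both components of `z - w` by its norm, the other from adding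
the two components of the field. -/
lemma norm_jointField_sub_le (hg : FieldBounds qx qy gx gy L G) (hqx : ∀ k, 0 ≤ qx k)
    (hqx₁ : ∑ k, qx k = 1) (hqy : ∀ k, 0 ≤ qy k) (hqy₁ : ∑ k, qy k = 1)
    (z w : JointStrat M₁ M₂) :
    ‖jointField qx qy gx gy z - jointField qx qy gx gy w‖ ≤ 4 * L * ‖z - w‖ := by
  have hz : ‖z.fst - w.fst‖ ≤ ‖z - w‖ := WithLp.norm_fst_le _ (z - w)
  have hw : ‖z.snd - w.snd‖ ≤ ‖z - w‖ := WithLp.norm_snd_le _ (z - w)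
  have hle : L * (‖z.fst - w.fst‖ + ‖z.snd - w.snd‖) ≤ 2 * L * ‖z - w‖ := by
    have := mul_le_mul_of_nonneg_left (add_le_add hz hw) hg.L_nonneg
    linarith
  have h₁ : ‖centroid qx ((fun k => gx k z.fst z.snd) - fun k => gx k w.fst w.snd)‖ ≤
      2 * L * ‖z - w‖ :=
    norm_centroid_le hqx hqx₁ fun k => (hg.lip_x k _ _ _ _).trans hle
  have h₂ : ‖centroid qy ((fun k => gy k z.fst z.snd) - fun k => gy k w.fst w.snd)‖ ≤
      2 * L * ‖z - w‖ :=
    norm_centroid_le hqy hqy₁ fun k => (hg.lip_y k _ _ _ _).trans hle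
  rw [centroid_sub] at h₁ h₂
  exact (norm_toLp_le _ _).trans ((add_le_add h₁ h₂).trans (le_of_eq (by ring)))

lemma IsRun.memLp_noise (h : IsRun Bx By gx gy μ σ P x y nx ny) (i : ℕ) :
    MemLp (fun ω => jointCentroid qx qy (nx i ω) (ny i ω)) 2 P :=
  memLp_jointCentroid (h.memLp_nx i) (h.memLp_ny i)

lemma continuous_centroid {S E : Type*} [TopologicalSpace S] [NormedAddCommGroup E]
    [NormedSpace ℝ E] (q : ι → ℝ) {f : S → ι → E} (hf : ∀ k, Continuous fun s => f s k) :
    Continuous fun s => centroid q (f s) :=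
  continuous_finsetSum _ fun k _ => (hf k).const_smul (q k)

variable [IsProbabilityMeasure P]

lemma IsRun.memLp_sampledField (h : IsRun Bx By gx gy μ σ P x y nx ny)
    (hg : FieldBounds qx qy gx gy L G) (i : ℕ) :
    MemLp (fun ω => sampledField qx qy gx gy (x i ω) (y i ω)) 2 P := by
  have hm := h.memLp hg i
  exact memLp_jointCentroid (fun k => (hg.lip_x k).memLp hg.L_nonneg (hm.1 k) (hm.2 k))
    fun k => (hg.lip_y k).memLp hg.L_nonneg (hm.1 k) (hm.2 k)

lemma IsRun.memLp_jointCentroid (h : IsRun Bx By gx gy μ σ P x y nx ny)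
    (hg : FieldBounds qx qy gx gy L G) (i : ℕ) :
    MemLp (fun ω => jointCentroid qx qy (x i ω) (y i ω)) 2 P :=
  CompetingNetworks.memLp_jointCentroid (h.memLp hg i).1 (h.memLp hg i).2

/-- The averaged noise is orthogonal to the noiseless update. -/
lemma IsRun.integral_inner_noise (h : IsRun Bx By gx gy μ σ P x y nx ny)
    (hg : FieldBounds qx qy gx gy L G) (zs : JointStrat M₁ M₂) (i : ℕ) :
    ∫ ω, inner ℝ (jointCentroid qx qy (x i ω) (y i ω) - zs -
        μ • sampledField qx qy gx gy (x i ω) (y i ω))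
      (jointCentroid qx qy (nx i ω) (ny i ω)) ∂P = 0 := by
  -- The components of the noiseless update are continuous functions of the current iterates. They
  -- are therefore admissible test functions for the orthogonality of each agent's noise.
  set H₁ : (ι → Strat M₁) × (ι → Strat M₂) → Strat M₁ := fun s =>
    centroid qx s.1 - zs.fst - μ • centroid qx fun k => gx k (s.1 k) (s.2 k)
  set H₂ : (ι → Strat M₁) × (ι → Strat M₂) → Strat M₂ := fun s =>
    centroid qy s.2 - zs.snd - μ • centroid qy fun k => gy k (s.1 k) (s.2 k)
  have hc₁ : Continuous H₁ := by
    refine ((continuous_centroid qx fun k => ?_).sub continuous_const).sub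
      ((continuous_centroid qx fun k => ?_).const_smul μ)
    · fun_prop
    · exact (hg.lip_x k).continuous.comp (by fun_prop :
        Continuous fun s : (ι → Strat M₁) × (ι → Strat M₂) => (s.1 k, s.2 k))
  have hc₂ : Continuous H₂ := by
    refine ((continuous_centroid qy fun k => ?_).sub continuous_const).sub
      ((continuous_centroid qy fun k => ?_).const_smul μ)
    · fun_prop
    · exact (hg.lip_y k).continuous.comp (by fun_prop :
        Continuous fun s : (ι → Strat M₁) × (ι → Strat M₂) => (s.1 k, s.2 k))
  have hm := ((h.memLp_jointCentroid hg i).sub (memLp_const zs)).sub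
    ((h.memLp_sampledField hg i).const_smul μ)
  have hm₁ : MemLp (fun ω => H₁ (x i ω, y i ω)) 2 P := (memLp_prodLp_iff.1 hm).1
  have hm₂ : MemLp (fun ω => H₂ (x i ω, y i ω)) 2 P := (memLp_prodLp_iff.1 hm).2
  have hi₁ := fun k => (integrable_inner_of_memLp hm₁ (h.memLp_nx i k)).const_mul (qx k)
  have hi₂ := fun k => (integrable_inner_of_memLp hm₂ (h.memLp_ny i k)).const_mul (qy k)
  calc _ = ∫ ω, (∑ k, qx k * inner ℝ (H₁ (x i ω, y i ω)) (nx i ω k) +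
        ∑ k, qy k * inner ℝ (H₂ (x i ω, y i ω)) (ny i ω k)) ∂P := by
        refine integral_congr_ae (ae_of_all _ fun ω => ?_)
        simp only [← inner_smul_right, ← inner_sum]
        rfl
    _ = 0 := by
        rw [integral_add (integrable_finsetSum _ fun k _ => hi₁ k)
          (integrable_finsetSum _ fun k _ => hi₂ k), integral_finsetSum _ fun k _ => hi₁ k,
          integral_finsetSum _ fun k _ => hi₂ k]
        simp only [integral_const_mul, h.nx_orth i _ H₁ hc₁ hm₁, h.ny_orth i _ H₂ hc₂ hm₂]
        simp

end Run

end CompetingNetworks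

namespace CompetingNetworks

/-! ### Scalar recursions and contraction of gradient steps. -/

section Recursions

lemma limsup_le_of_contractive {u : ℕ → ℝ} {d c : ℝ} (hd : 0 ≤ d) (hd₁ : d < 1)
    (hu : ∀ i, 0 ≤ u i) (h : ∀ i, u (i + 1) ≤ d * u i + c) :
    IsBoundedUnder (· ≤ ·) atTop u ∧ limsup u atTop ≤ c / (1 - d) := by
  have h1 : 0 < 1 - d := by linarith
  have hle : ∀ i, u i ≤ d ^ i * (u 0 - c / (1 - d)) + c / (1 - d) := by
    intro i
    induction i with
    | zero => simp
    | succ i ih =>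
      refine (h i).trans ((add_le_add_left (mul_le_mul_of_nonneg_left ih hd) c).trans
        (le_of_eq ?_))
      rw [pow_succ]
      field_simp
      ring
  have ht : Tendsto (fun i : ℕ => d ^ i * (u 0 - c / (1 - d)) + c / (1 - d)) atTop
      (nhds (c / (1 - d))) := by
    simpa using ((tendsto_pow_atTop_nhds_zero_of_lt_one hd hd₁).mul_const
      (u 0 - c / (1 - d))).add_const (c / (1 - d))
  refine ⟨ht.isBoundedUnder_le.mono_le (Eventually.of_forall hle), ?_⟩
  rw [← ht.limsup_eq]
  exact limsup_le_limsup (Eventually.of_forall hle)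
    (isBoundedUnder_of_eventually_ge (Eventually.of_forall hu)).isCoboundedUnder_le
    ht.isBoundedUnder_le

variable {E : Type*} [NormedAddCommGroup E] [InnerProductSpace ℝ E]

/-- Young's inequality with weight `ν μ`: the loss `1 + ν μ` is small enough to be recovered from
the contraction in `norm_gradient_step_sq_le`. -/
lemma norm_sub_smul_sq_le {ν μ : ℝ} (hν : 0 < ν) (hμ : 0 ≤ μ) (a s : E) :
    ‖a - μ • s‖ ^ 2 ≤ (1 + ν * μ) * ‖a‖ ^ 2 + (μ ^ 2 + μ / ν) * ‖s‖ ^ 2 := by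
  have h₁ : ‖a - μ • s‖ ≤ ‖a‖ + μ * ‖s‖ := by
    refine (norm_sub_le _ _).trans ?_
    rw [norm_smul, Real.norm_of_nonneg hμ]
  have h₂ := pow_le_pow_left₀ (norm_nonneg _) h₁ 2
  refine h₂.trans (sub_nonneg.1 ?_)
  have : (1 + ν * μ) * ‖a‖ ^ 2 + (μ ^ 2 + μ / ν) * ‖s‖ ^ 2 - (‖a‖ + μ * ‖s‖) ^ 2 =
      μ / ν * (ν * ‖a‖ - ‖s‖) ^ 2 := by
    field_simp
    ring
  rw [this]
  positivity

/-- A gradient step along a strongly monotone Lipschitz field contracts. -/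
lemma norm_gradient_step_sq_le {ν μ Λ : ℝ} (hν : 0 ≤ ν) (hμ : 0 ≤ μ)
    (hΛ : 4 * Λ ^ 2 * μ ≤ ν) {w f : E} (hf : ‖f‖ ≤ Λ * ‖w‖) (hm : ν * ‖w‖ ^ 2 ≤ inner ℝ f w) :
    (1 + ν * μ) * ‖w - μ • f‖ ^ 2 ≤ (1 - ν * μ / 2) * ‖w‖ ^ 2 := by
  -- Of the gain `2 ν μ`, one `ν μ` pays for the factor `1 + ν μ`, and the condition on `μ` leaves
  -- at least half of the other.
  have h₁ : ‖w - μ • f‖ ^ 2 ≤ (1 - 2 * (ν * μ) + Λ ^ 2 * μ ^ 2) * ‖w‖ ^ 2 := by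
    rw [norm_sub_sq_real, inner_smul_right, norm_smul, Real.norm_of_nonneg hμ, mul_pow,
      real_inner_comm]
    have h₂ : ‖f‖ ^ 2 ≤ Λ ^ 2 * ‖w‖ ^ 2 := by
      rw [← mul_pow]; exact pow_le_pow_left₀ (norm_nonneg _) hf 2
    have h₃ := mul_le_mul_of_nonneg_left h₂ (sq_nonneg μ)
    have h₄ := mul_le_mul_of_nonneg_left hm hμ
    linarith
  refine (mul_le_mul_of_nonneg_left h₁ (by positivity)).trans ?_
  rw [← mul_assoc]
  refine mul_le_mul_of_nonneg_right ?_ (sq_nonneg _)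
  have h₅ := mul_le_mul_of_nonneg_right hΛ hμ
  have h₆ : 0 ≤ Λ ^ 2 * μ ^ 2 := by positivity
  have h₇ : 0 ≤ ν * μ := by positivity
  nlinarith

end Recursions

/-! ### Mean-square learning dynamics and stability of the centroids. -/

section Run

variable {ι : Type*} [Fintype ι] {M₁ M₂ : ℕ} {Ω : Type*} [MeasurableSpace Ω]
  {Bx By : Matrix ι ι ℝ} {qx qy : ι → ℝ} {gx : ι → Strat M₁ → Strat M₂ → Strat M₁}
  {gy : ι → Strat M₁ → Strat M₂ → Strat M₂} {L G μ σ : ℝ} {P : Measure Ω}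
  {x : ℕ → Ω → ι → Strat M₁} {y : ℕ → Ω → ι → Strat M₂}
  {nx : ℕ → Ω → ι → Strat M₁} {ny : ℕ → Ω → ι → Strat M₂}
  {α Γ : ℝ} {Wx : (ι → Strat M₁) → ℝ} {Wy : (ι → Strat M₂) → ℝ}

/-- The averaged noise has bounded variance. -/
lemma IsRun.integral_noise_sq_le [DecidableEq ι] (h : IsRun Bx By gx gy μ σ P x y nx ny)
    (hBx : IsErgodic Bx qx) (hBy : IsErgodic By qy) (i : ℕ) :
    ∫ ω, ‖jointCentroid qx qy (nx i ω) (ny i ω)‖ ^ 2 ∂P ≤ 16 * Fintype.card ι ^ 2 * σ ^ 2 := by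
  have hN := (h.memLp_noiseSize i).integrable_sq
  calc _ ≤ ∫ ω, 4 * noiseSize (nx i ω) (ny i ω) ^ 2 ∂P := by
        refine integral_mono (integrable_norm_sq_of_memLp (h.memLp_noise i)) (hN.const_mul 4)
          fun ω => ?_
        have := pow_le_pow_left₀ (norm_nonneg _) (norm_jointCentroid_noise_le hBx.nonneg
          hBx.sum_eq_one hBy.nonneg hBy.sum_eq_one (nx i ω) (ny i ω)) 2
        simp only
        linarith
    _ ≤ _ := by
        rw [integral_const_mul]
        linarith [h.integral_noiseSize_sq_le i]

variable [IsProbabilityMeasure P]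

lemma IsRun.memLp_jointField (h : IsRun Bx By gx gy μ σ P x y nx ny)
    (hg : FieldBounds qx qy gx gy L G) (i : ℕ) :
    MemLp (fun ω => jointField qx qy gx gy (jointCentroid qx qy (x i ω) (y i ω))) 2 P := by
  have hm := h.memLp hg i
  have hxc := memLp_centroid qx hm.1
  have hyc := memLp_centroid qy hm.2
  exact CompetingNetworks.memLp_jointCentroid
    (fun k => (hg.lip_x k).memLp hg.L_nonneg hxc hyc)
    fun k => (hg.lip_y k).memLp hg.L_nonneg hxc hyc

variable [DecidableEq ι]

/-- The gradients sampled by the agents agree with those at the centroids up to the consensus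
error. -/
lemma IsRun.integral_sampledField_sub_sq_le (h : IsRun Bx By gx gy μ σ P x y nx ny)
    (hg : FieldBounds qx qy gx gy L G) (hBx : IsErgodic Bx qx) (hBy : IsErgodic By qy)
    (hWx : IsContractedBy (deviation Bx qx) α Γ Wx)
    (hWy : IsContractedBy (deviation By qy) α Γ Wy) (hα : 0 < α) (hα₁ : α < 1) (hΓ : 0 ≤ Γ)
    (hμ : 0 ≤ μ) (hμs : μ * (2 * Γ * L) ≤ (1 - α) / 2) (i : ℕ) :
    Integrable (fun ω => ‖sampledField qx qy gx gy (x i ω) (y i ω) -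
      jointField qx qy gx gy (jointCentroid qx qy (x i ω) (y i ω))‖ ^ 2) P ∧
    ∫ ω, ‖sampledField qx qy gx gy (x i ω) (y i ω) -
      jointField qx qy gx gy (jointCentroid qx qy (x i ω) (y i ω))‖ ^ 2 ∂P ≤
        μ ^ 2 * (4 * L ^ 2 * consensusConst (Fintype.card ι) α Γ G σ) := by
  have hF := h.memLp_jointField hg i
  have hint := integrable_norm_sq_of_memLp ((h.memLp_sampledField hg i).sub hF)
  refine ⟨hint, ?_⟩
  have hV := (h.memLp_errSize hg hWx hWy i).integrable_sq
  calc _ ≤ ∫ ω, 4 * L ^ 2 * errSize Wx Wy qx qy (x i ω) (y i ω) ^ 2 ∂P := by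
        refine integral_mono hint (hV.const_mul _) fun ω => ?_
        have := pow_le_pow_left₀ (norm_nonneg _) (norm_sampledField_sub_le hg hBx.nonneg
          hBx.sum_eq_one hBy.nonneg hBy.sum_eq_one
          (norm_dev_add_le_errSize hWx hWy (x i ω) (y i ω))) 2
        refine this.trans (le_of_eq (by ring))
    _ ≤ _ := by
        rw [integral_const_mul]
        have := mul_le_mul_of_nonneg_left (h.integral_errSize_sq_le hg hBx hBy hWx hWy hα hα₁ hΓ
          hμ hμs i) (by positivity : 0 ≤ 4 * L ^ 2)
        linarith

/-- Learning dynamics: up to a mean-square error of order `μ²`, the centroids take gradient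
steps. -/
theorem IsRun.integral_dynamics_error_sq_le (h : IsRun Bx By gx gy μ σ P x y nx ny)
    (hg : FieldBounds qx qy gx gy L G) (hBx : IsErgodic Bx qx) (hBy : IsErgodic By qy)
    (hWx : IsContractedBy (deviation Bx qx) α Γ Wx)
    (hWy : IsContractedBy (deviation By qy) α Γ Wy) (hα : 0 < α) (hα₁ : α < 1) (hΓ : 0 ≤ Γ)
    (hμ : 0 ≤ μ) (hμ₁ : μ ≤ 1) (hμs : μ * (2 * Γ * L) ≤ (1 - α) / 2) (i : ℕ) :
    Integrable (fun ω => ‖jointCentroid qx qy (x (i + 1) ω) (y (i + 1) ω) -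
      (jointCentroid qx qy (x i ω) (y i ω) -
        μ • jointField qx qy gx gy (jointCentroid qx qy (x i ω) (y i ω)))‖ ^ 2) P ∧
    ∫ ω, ‖jointCentroid qx qy (x (i + 1) ω) (y (i + 1) ω) -
      (jointCentroid qx qy (x i ω) (y i ω) -
        μ • jointField qx qy gx gy (jointCentroid qx qy (x i ω) (y i ω)))‖ ^ 2 ∂P ≤
      (8 * L ^ 2 * consensusConst (Fintype.card ι) α Γ G σ +
        32 * Fintype.card ι ^ 2 * σ ^ 2) * μ ^ 2 := by
  obtain ⟨hSi, hS⟩ := h.integral_sampledField_sub_sq_le hg hBx hBy hWx hWy hα hα₁ hΓ hμ hμs i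
  have hN := h.integral_noise_sq_le hBx hBy i
  have hNi := integrable_norm_sq_of_memLp (h.memLp_noise (qx := qx) (qy := qy) i)
  have hF := h.memLp_jointField hg i
  have hint := integrable_norm_sq_of_memLp ((h.memLp_jointCentroid hg (i + 1)).sub
    ((h.memLp_jointCentroid hg i).sub (hF.const_smul μ)))
  refine ⟨hint, ?_⟩
  calc _ ≤ ∫ ω, 2 * μ ^ 2 * (‖sampledField qx qy gx gy (x i ω) (y i ω) -
          jointField qx qy gx gy (jointCentroid qx qy (x i ω) (y i ω))‖ ^ 2 +
          ‖jointCentroid qx qy (nx i ω) (ny i ω)‖ ^ 2) ∂P := by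
        refine integral_mono hint ((hSi.add hNi).const_mul _) fun ω => ?_
        simp only [h.jointCentroid_succ hBx.eigen hBy.eigen]
        set z := jointCentroid qx qy (x i ω) (y i ω)
        set s := sampledField qx qy gx gy (x i ω) (y i ω)
        set n := jointCentroid qx qy (nx i ω) (ny i ω)
        set f := jointField qx qy gx gy z
        have h₁ : z - μ • (s + n) - (z - μ • f) = -(μ • ((s - f) + n)) := by
          simp only [smul_add, smul_sub]; abel
        rw [h₁, norm_neg, norm_smul, mul_pow, Real.norm_of_nonneg hμ]
        have h₂ := pow_le_pow_left₀ (norm_nonneg _) (norm_add_le (s - f) n) 2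
        have h₃ := h₂.trans add_sq_le
        have h₄ := mul_le_mul_of_nonneg_left h₃ (sq_nonneg μ)
        linarith
    _ ≤ _ := by
        rw [integral_const_mul, integral_add hSi hNi]
        have hK := consensusConst_nonneg (Fintype.card ι) α Γ G σ
        -- The sampling mismatch is itself of order `μ²` in mean square, so after multiplication by
        -- `μ²` the noise dominates; `μ ≤ 1` suffices to merge both terms.
        have hμ2 : μ ^ 2 ≤ 1 := pow_le_one₀ hμ hμ₁
        have hS' := hS.trans (mul_le_mul_of_nonneg_right hμ2 (by positivity))
        have := mul_le_mul_of_nonneg_left (add_le_add hS' hN) (by positivity : 0 ≤ 2 * μ ^ 2)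
        linarith

/-- Mean-square contraction towards a zero of a strongly monotone field. -/
theorem IsRun.integral_dist_zero_sq_le (h : IsRun Bx By gx gy μ σ P x y nx ny)
    (hg : FieldBounds qx qy gx gy L G) (hBx : IsErgodic Bx qx) (hBy : IsErgodic By qy)
    (hWx : IsContractedBy (deviation Bx qx) α Γ Wx)
    (hWy : IsContractedBy (deviation By qy) α Γ Wy) (hα : 0 < α) (hα₁ : α < 1) (hΓ : 0 ≤ Γ)
    (hμ : 0 ≤ μ) (hμ₁ : μ ≤ 1) (hμs : μ * (2 * Γ * L) ≤ (1 - α) / 2)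
    {ν : ℝ} (hν : 0 < ν) (hLμ : 64 * L ^ 2 * μ ≤ ν) {zs : JointStrat M₁ M₂}
    (hzs : jointField qx qy gx gy zs = 0)
    (hmono : ∀ z w : JointStrat M₁ M₂, ν * ‖z - w‖ ^ 2 ≤
      inner ℝ (jointField qx qy gx gy z - jointField qx qy gx gy w) (z - w)) (i : ℕ) :
    ∫ ω, ‖jointCentroid qx qy (x (i + 1) ω) (y (i + 1) ω) - zs‖ ^ 2 ∂P ≤
      (1 - ν * μ / 2) * ∫ ω, ‖jointCentroid qx qy (x i ω) (y i ω) - zs‖ ^ 2 ∂P +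
      (4 * L ^ 2 * (1 + 1 / ν) * consensusConst (Fintype.card ι) α Γ G σ +
        16 * Fintype.card ι ^ 2 * σ ^ 2) * μ ^ 2 := by
  obtain ⟨hSi, hS⟩ := h.integral_sampledField_sub_sq_le hg hBx hBy hWx hWy hα hα₁ hΓ hμ hμs i
  have hN := h.integral_noise_sq_le hBx hBy i
  have hNm := h.memLp_noise (qx := qx) (qy := qy) i
  have hNi := integrable_norm_sq_of_memLp hNm
  have hzm : MemLp (fun ω => jointCentroid qx qy (x i ω) (y i ω) - zs) 2 P :=
    (h.memLp_jointCentroid hg i).sub (memLp_const zs)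
  have hzi := integrable_norm_sq_of_memLp hzm
  have hum : MemLp (fun ω => jointCentroid qx qy (x i ω) (y i ω) - zs -
      μ • sampledField qx qy gx gy (x i ω) (y i ω)) 2 P :=
    hzm.sub ((h.memLp_sampledField hg i).const_smul μ)
  have hui := integrable_norm_sq_of_memLp hum
  have hin := integrable_inner_of_memLp hum hNm
  have h₀ : ∀ ω, ‖jointCentroid qx qy (x (i + 1) ω) (y (i + 1) ω) - zs‖ ^ 2 =
      ‖jointCentroid qx qy (x i ω) (y i ω) - zs -
        μ • sampledField qx qy gx gy (x i ω) (y i ω)‖ ^ 2 -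
      2 * μ * inner ℝ (jointCentroid qx qy (x i ω) (y i ω) - zs -
        μ • sampledField qx qy gx gy (x i ω) (y i ω)) (jointCentroid qx qy (nx i ω) (ny i ω)) +
      μ ^ 2 * ‖jointCentroid qx qy (nx i ω) (ny i ω)‖ ^ 2 := by
    intro ω
    rw [h.jointCentroid_succ hBx.eigen hBy.eigen]
    set z := jointCentroid qx qy (x i ω) (y i ω)
    set s := sampledField qx qy gx gy (x i ω) (y i ω)
    set n := jointCentroid qx qy (nx i ω) (ny i ω)
    have h₁ : z - μ • (s + n) - zs = (z - zs - μ • s) - μ • n := by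
      simp only [smul_add]; abel
    rw [h₁, norm_sub_sq_real, inner_smul_right, norm_smul, mul_pow, Real.norm_of_nonneg hμ]
    ring
  have hpt : ∀ ω, ‖jointCentroid qx qy (x i ω) (y i ω) - zs -
        μ • sampledField qx qy gx gy (x i ω) (y i ω)‖ ^ 2 ≤
      (1 - ν * μ / 2) * ‖jointCentroid qx qy (x i ω) (y i ω) - zs‖ ^ 2 +
        (μ ^ 2 + μ / ν) * ‖sampledField qx qy gx gy (x i ω) (y i ω) -
          jointField qx qy gx gy (jointCentroid qx qy (x i ω) (y i ω))‖ ^ 2 := by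
    intro ω
    set z := jointCentroid qx qy (x i ω) (y i ω)
    set s := sampledField qx qy gx gy (x i ω) (y i ω)
    set f := jointField qx qy gx gy z
    -- The update splits into an exact gradient step from the centroid and the sampling mismatch,
    -- which is controlled by the consensus error.
    have h₁ : z - zs - μ • s = (z - zs - μ • f) - μ • (s - f) := by
      simp only [smul_sub]; abel
    have h₂ : ‖f‖ ≤ 4 * L * ‖z - zs‖ := by
      have := norm_jointField_sub_le hg hBx.nonneg hBx.sum_eq_one hBy.nonneg hBy.sum_eq_one z zs
      rwa [hzs, sub_zero] at this
    have h₃ := hmono z zs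
    rw [hzs, sub_zero] at h₃
    rw [h₁]
    refine (norm_sub_smul_sq_le hν hμ _ _).trans (add_le_add_left
      (norm_gradient_step_sq_le hν.le hμ ?_ h₂ h₃) _)
    -- With Lipschitz constant `Λ = 4 L`, the requirement `4 Λ² μ ≤ ν` is `64 L² μ ≤ ν`.
    linarith [hLμ]
  have hK := consensusConst_nonneg (Fintype.card ι) α Γ G σ
  have hcoef : (μ ^ 2 + μ / ν) * μ ^ 2 ≤ (1 + 1 / ν) * μ ^ 2 := by
    refine mul_le_mul_of_nonneg_right (add_le_add (pow_le_one₀ hμ hμ₁) ?_) (sq_nonneg μ)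
    gcongr
  calc _ = ∫ ω, ‖jointCentroid qx qy (x i ω) (y i ω) - zs -
          μ • sampledField qx qy gx gy (x i ω) (y i ω)‖ ^ 2 ∂P +
        μ ^ 2 * ∫ ω, ‖jointCentroid qx qy (nx i ω) (ny i ω)‖ ^ 2 ∂P := by
        simp only [h₀]
        have hsub : Integrable (fun ω => ‖jointCentroid qx qy (x i ω) (y i ω) - zs -
              μ • sampledField qx qy gx gy (x i ω) (y i ω)‖ ^ 2 -
            2 * μ * inner ℝ (jointCentroid qx qy (x i ω) (y i ω) - zs -
              μ • sampledField qx qy gx gy (x i ω) (y i ω))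
              (jointCentroid qx qy (nx i ω) (ny i ω))) P := hui.sub (hin.const_mul _)
        rw [integral_add hsub (hNi.const_mul _),
          integral_sub hui (hin.const_mul _), integral_const_mul, integral_const_mul,
          h.integral_inner_noise hg zs i]
        ring
    _ ≤ ((1 - ν * μ / 2) * ∫ ω, ‖jointCentroid qx qy (x i ω) (y i ω) - zs‖ ^ 2 ∂P +
        (μ ^ 2 + μ / ν) * (μ ^ 2 * (4 * L ^ 2 * consensusConst (Fintype.card ι) α Γ G σ))) +
        μ ^ 2 * (16 * Fintype.card ι ^ 2 * σ ^ 2) := by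
        refine add_le_add ?_ (mul_le_mul_of_nonneg_left hN (sq_nonneg μ))
        refine (integral_mono hui ((hzi.const_mul (1 - ν * μ / 2)).add
          (hSi.const_mul (μ ^ 2 + μ / ν))) hpt).trans ?_
        rw [integral_add' (hzi.const_mul _) (hSi.const_mul _), integral_const_mul,
          integral_const_mul]
        have : 0 ≤ μ ^ 2 + μ / ν := by positivity
        exact add_le_add_right (mul_le_mul_of_nonneg_left hS this) _
    _ ≤ _ := by
        have := mul_le_mul_of_nonneg_right hcoef
          (by positivity : 0 ≤ 4 * L ^ 2 * consensusConst (Fintype.card ι) α Γ G σ)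
        linarith

end Run

end CompetingNetworks

namespace CompetingNetworks

/-! ### The two leader-follower chains of the network are ergodic. -/

section NetworkChains

open Matrix

variable {K₁ K₂ : ℕ}

/-- The chain that propagates the strategy of Team 1 through both teams. -/
noncomputable def Network.chain₁ (N : Network K₁ K₂) : Matrix (Agent K₁ K₂) (Agent K₁ K₂) ℝ :=
  Matrix.fromBlocks N.A₁ (N.A₁ * N.C.toBlocks₁₂) 0 N.C.toBlocks₂₂

/-- The chain that propagates the strategy of Team 2 through both teams. -/
noncomputable def Network.chain₂ (N : Network K₁ K₂) : Matrix (Agent K₁ K₂) (Agent K₁ K₂) ℝ :=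
  Matrix.fromBlocks N.C.toBlocks₁₁ 0 (N.A₂ * N.C.toBlocks₂₁) N.A₂

lemma sum_col_mul {m n : Type*} [Fintype m] [DecidableEq m] {A : Matrix m m ℝ}
    (hA : A ∈ colStochastic ℝ m) (R : Matrix m n ℝ) (k : n) :
    ∑ l, (A * R) l k = ∑ l, R l k := by
  simp only [Matrix.mul_apply]
  rw [Finset.sum_comm]
  refine Finset.sum_congr rfl fun j _ => ?_
  rw [← Finset.sum_mul, sum_col_of_mem_colStochastic hA, one_mul]

/-- Team 1 takes no information about its own strategy from Team 2, so the stationary weight rests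
on Team 1 alone. Premultiplying by `A₁` keeps the column sums of `C₁₂`, hence the columns of Team 2
sum to one as in `C`. -/
lemma Network.IsWeak.isErgodic₁ {N : Network K₁ K₂} (h : N.IsWeak) {p₁ : Fin K₁ → ℝ}
    (hp : IsPerronVector N.A₁ p₁) : IsErgodic N.chain₁ (Sum.elim p₁ 0) := by
  have hA := fun i j => nonneg_of_mem_colStochastic h.leftStochastic₁ (i := i) (j := j)
  have hC := fun i j => nonneg_of_mem_colStochastic h.leftStochastic (i := i) (j := j)
  have hnn : ∀ i j, 0 ≤ N.chain₁ i j := by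
    rintro (i | i) (j | j)
    · exact hA i j
    · rw [Network.chain₁, fromBlocks_apply₁₂, Matrix.mul_apply]
      exact Finset.sum_nonneg fun l _ => mul_nonneg (hA i l) (hC _ _)
    · exact le_rfl
    · exact hC _ _
  refine ⟨mem_colStochastic_iff_sum.2 ⟨hnn, ?_⟩, ?_, ?_, ?_, ?_⟩
  · rintro (k | k)
    · simp [Network.chain₁, sum_col_of_mem_colStochastic h.leftStochastic₁]
    · have := sum_col_of_mem_colStochastic h.leftStochastic (Sum.inr k)
      rw [Fintype.sum_sum_type] at this ⊢
      simp only [Network.chain₁, fromBlocks_apply₁₂, fromBlocks_apply₂₂,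
        sum_col_mul h.leftStochastic₁]
      exact this
  · rw [Network.chain₁, Matrix.fromBlocks_mulVec]
    have h₁ : (Sum.elim p₁ 0 : Agent K₁ K₂ → ℝ) ∘ Sum.inl = p₁ := rfl
    have h₂ : (Sum.elim p₁ 0 : Agent K₁ K₂ → ℝ) ∘ Sum.inr = 0 := rfl
    rw [h₁, h₂]
    simp [hp.eigen]
  · rintro (k | k)
    · exact (hp.pos k).le
    · exact le_rfl
  · simp [hp.sum_eq_one]
  · have hne : Nonempty (Fin K₁) := by
      by_contra hempty
      rw [not_nonempty_iff] at hempty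
      simpa using hp.sum_eq_one
    obtain ⟨a⟩ := hne
    refine ⟨Sum.inl a, eventually_pow_pos_of_leader_follower hnn h.primitive₁ h.leftStochastic₁
      h.irreducible₂ Sum.inl Sum.inr ?_ (fun a b hab => hab) (fun a b hab => hab) ?_ a⟩
    · rintro (i | i) <;> simp
    · obtain ⟨l, k, hlk⟩ := h.link₁₂
      -- The cross-team block is `A₁ C₁₂`, so the link out of `l` must be preceded by an agent `c`
      -- that `l` listens to.
      obtain ⟨c, hc⟩ := exists_col_pos h.leftStochastic₁ l
      exact ⟨c, k, mul_apply_pos (B := N.C.toBlocks₁₂) hA (fun i j => hC _ _) hc hlk⟩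

lemma Network.IsWeak.isErgodic₂ {N : Network K₁ K₂} (h : N.IsWeak) {p₂ : Fin K₂ → ℝ}
    (hp : IsPerronVector N.A₂ p₂) : IsErgodic N.chain₂ (Sum.elim 0 p₂) := by
  have hA := fun i j => nonneg_of_mem_colStochastic h.leftStochastic₂ (i := i) (j := j)
  have hC := fun i j => nonneg_of_mem_colStochastic h.leftStochastic (i := i) (j := j)
  have hnn : ∀ i j, 0 ≤ N.chain₂ i j := by
    rintro (i | i) (j | j)
    · exact hC _ _
    · exact le_rfl
    · rw [Network.chain₂, fromBlocks_apply₂₁, Matrix.mul_apply]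
      exact Finset.sum_nonneg fun l _ => mul_nonneg (hA i l) (hC _ _)
    · exact hA i j
  refine ⟨mem_colStochastic_iff_sum.2 ⟨hnn, ?_⟩, ?_, ?_, ?_, ?_⟩
  · rintro (k | k)
    · have := sum_col_of_mem_colStochastic h.leftStochastic (Sum.inl k)
      rw [Fintype.sum_sum_type] at this ⊢
      simp only [Network.chain₂, fromBlocks_apply₁₁, fromBlocks_apply₂₁,
        sum_col_mul h.leftStochastic₂]
      exact this
    · simp [Network.chain₂, sum_col_of_mem_colStochastic h.leftStochastic₂]
  · rw [Network.chain₂, Matrix.fromBlocks_mulVec]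
    have h₁ : (Sum.elim 0 p₂ : Agent K₁ K₂ → ℝ) ∘ Sum.inl = 0 := rfl
    have h₂ : (Sum.elim 0 p₂ : Agent K₁ K₂ → ℝ) ∘ Sum.inr = p₂ := rfl
    rw [h₁, h₂]
    simp [hp.eigen]
  · rintro (k | k)
    · exact le_rfl
    · exact (hp.pos k).le
  · simp [hp.sum_eq_one]
  · have hne : Nonempty (Fin K₂) := by
      by_contra hempty
      rw [not_nonempty_iff] at hempty
      simpa using hp.sum_eq_one
    obtain ⟨a⟩ := hne
    refine ⟨Sum.inr a, eventually_pow_pos_of_leader_follower hnn h.primitive₂ h.leftStochastic₂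
      h.irreducible₁ Sum.inr Sum.inl ?_ (fun a b hab => hab) (fun a b hab => hab) ?_ a⟩
    · rintro (i | i) <;> simp
    · obtain ⟨l, k, hlk⟩ := h.link₂₁
      obtain ⟨c, hc⟩ := exists_col_pos h.leftStochastic₂ l
      exact ⟨c, k, mul_apply_pos (B := N.C.toBlocks₂₁) hA (fun i j => hC _ _) hc hlk⟩

end NetworkChains

/-! ### Zeros of strongly monotone fields and minimizers. -/

section StronglyMonotoneFields

variable {E : Type*} [NormedAddCommGroup E] [InnerProductSpace ℝ E]

lemma eq_of_strongly_monotone {F : E → E} {ν : ℝ} (hν : 0 < ν)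
    (hm : ∀ z w, ν * ‖z - w‖ ^ 2 ≤ inner ℝ (F z - F w) (z - w)) {z w : E} (hz : F z = 0)
    (hw : F w = 0) : z = w := by
  have h := hm z w
  rw [hz, hw, sub_zero, inner_zero_left] at h
  have h' : ‖z - w‖ ^ 2 ≤ 0 := by
    by_contra hcon
    have := mul_pos hν (not_le.1 hcon)
    linarith
  have := pow_eq_zero_iff two_ne_zero |>.1 (le_antisymm h' (sq_nonneg _))
  exact sub_eq_zero.1 (norm_eq_zero.1 this)

variable [CompleteSpace E]

/-- A strongly monotone Lipschitz field has a zero. -/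
lemma exists_zero_of_strongly_monotone {F : E → E} {ν Λ : ℝ} (hν : 0 < ν)
    (hF : ∀ z w, ‖F z - F w‖ ≤ Λ * ‖z - w‖)
    (hm : ∀ z w, ν * ‖z - w‖ ^ 2 ≤ inner ℝ (F z - F w) (z - w)) : ∃ z, F z = 0 := by
  -- This auxiliary step size satisfies both `4 Λ² μ ≤ ν` and `ν μ ≤ 1`, even when `Λ = 0`. The zero
  -- is the Banach fixed point of `z ↦ z - μ F z`.
  set μ : ℝ := ν / (4 * Λ ^ 2 + ν ^ 2)
  have hden : 0 < 4 * Λ ^ 2 + ν ^ 2 := by positivity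
  have hμ : 0 < μ := by positivity
  have h₁ : 4 * Λ ^ 2 * μ ≤ ν := by
    rw [mul_div_assoc', div_le_iff₀ hden]
    nlinarith [pow_pos hν 3]
  have hνμ : ν * μ ≤ 1 := by
    rw [mul_div_assoc', div_le_one hden]
    nlinarith [sq_nonneg Λ]
  have hνμ0 : 0 < ν * μ := by positivity
  have hlip : LipschitzWith (Real.toNNReal (√(1 - ν * μ / 2))) fun z => z - μ • F z := by
    refine LipschitzWith.of_dist_le_mul fun z w => ?_
    rw [dist_eq_norm, dist_eq_norm, Real.coe_toNNReal _ (Real.sqrt_nonneg _)]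
    have h₂ := norm_gradient_step_sq_le hν.le hμ.le h₁ (hF z w) (hm z w)
    have h₃ : z - μ • F z - (w - μ • F w) = z - w - μ • (F z - F w) := by
      rw [smul_sub]; abel
    rw [h₃]
    refine le_of_sq_le_sq ?_ (by positivity)
    rw [mul_pow, Real.sq_sqrt (by linarith)]
    refine le_trans ?_ h₂
    have := mul_nonneg hνμ0.le (sq_nonneg ‖z - w - μ • (F z - F w)‖)
    linarith
  have hc : ContractingWith (Real.toNNReal (√(1 - ν * μ / 2))) fun z => z - μ • F z := by
    refine ⟨?_, hlip⟩
    rw [← NNReal.coe_lt_coe, Real.coe_toNNReal _ (Real.sqrt_nonneg _), NNReal.coe_one,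
      Real.sqrt_lt' one_pos]
    linarith
  have hfix : hc.fixedPoint _ - μ • F (hc.fixedPoint _) = hc.fixedPoint _ :=
    hc.fixedPoint_isFixedPt
  rw [sub_eq_self, smul_eq_zero] at hfix
  exact ⟨_, hfix.resolve_left hμ.ne'⟩

/-- A critical point of a function with monotone gradient is a global minimizer. -/
lemma le_of_gradient_eq_zero_of_monotone {f : E → ℝ} (hf : Differentiable ℝ f)
    (hm : ∀ u v, 0 ≤ inner ℝ (gradient f u - gradient f v) (u - v)) {u : E}
    (hu : gradient f u = 0) (v : E) : f u ≤ f v := by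
  have hd : ∀ t : ℝ, HasDerivAt (fun t : ℝ => f (u + t • (v - u)))
      (inner ℝ (gradient f (u + t • (v - u))) (v - u)) t := by
    intro t
    have h₁ : HasDerivAt (fun t : ℝ => u + t • (v - u)) (v - u) t := by
      simpa using ((hasDerivAt_id t).smul_const (v - u)).const_add u
    have h₂ := (hf (u + t • (v - u))).hasFDerivAt.comp_hasDerivAt t h₁
    rwa [← inner_gradient_left] at h₂
  have hmono : MonotoneOn (fun t : ℝ => f (u + t • (v - u))) (Set.Icc 0 1) := by
    refine monotoneOn_of_deriv_nonneg (convex_Icc 0 1)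
      (fun t _ => (hd t).continuousAt.continuousWithinAt)
      (fun t _ => (hd t).differentiableAt.differentiableWithinAt) fun t ht => ?_
    rw [interior_Icc] at ht
    rw [(hd t).deriv]
    -- Monotonicity between this point and the critical point `u` gives `t` times the derivative
    -- along the segment, and `t > 0`.
    have h := hm (u + t • (v - u)) u
    rw [hu, sub_zero, add_sub_cancel_left, inner_smul_right] at h
    exact nonneg_of_mul_nonneg_right h ht.1
  simpa using hmono (Set.left_mem_Icc.2 zero_le_one) (Set.right_mem_Icc.2 zero_le_one) zero_le_one

lemma gradient_eq_zero_of_forall_le {f : E → ℝ} {u : E} (h : ∀ v, f u ≤ f v) :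
    gradient f u = 0 := by
  have : fderiv ℝ f u = 0 := IsLocalMin.fderiv_eq_zero (Eventually.of_forall h)
  simp [gradient, this]

lemma gradient_weighted_sum {ι : Type*} [Fintype ι] (q : ι → ℝ) {f : ι → E → ℝ}
    (hf : ∀ k, Differentiable ℝ (f k)) (u : E) :
    gradient (fun v => ∑ k, q k * f k v) u = ∑ k, q k • gradient (f k) u := by
  have : fderiv ℝ (fun v => ∑ k, q k * f k v) u = ∑ k, q k • fderiv ℝ (f k) u := by
    rw [fderiv_fun_sum fun k _ => ((hf k) u).const_mul (q k)]
    exact Finset.sum_congr rfl fun k _ => fderiv_const_mul ((hf k) u) _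
  simp [gradient, this]

end StronglyMonotoneFields

/-! ### From the game to gradient fields; Nash equilibria as zeros of `F`. -/

namespace Game

variable {K₁ K₂ M₁ M₂ : ℕ} {𝒢 : Game K₁ K₂ M₁ M₂} {p₁ : Fin K₁ → ℝ} {p₂ : Fin K₂ → ℝ} {L G : ℝ}

/-- The gradients that the agents use for the strategy of Team 1. -/
noncomputable def fieldX (𝒢 : Game K₁ K₂ M₁ M₂) : Agent K₁ K₂ → Strat M₁ → Strat M₂ → Strat M₁ :=
  Sum.elim (fun k => gradX (𝒢.J (Sum.inl k))) fun k => gradX (𝒢.Jopp₁ k)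

/-- The gradients that the agents use for the strategy of Team 2. -/
noncomputable def fieldY (𝒢 : Game K₁ K₂ M₁ M₂) : Agent K₁ K₂ → Strat M₁ → Strat M₂ → Strat M₂ :=
  Sum.elim (fun k => gradY (𝒢.Jopp₂ k)) fun k => gradY (𝒢.J (Sum.inr k))

/-- The Perron weights vanish on Team 2, so its models of the cost of Team 1 do not enter the
average. -/
lemma Regular.meanField_fieldX (h : 𝒢.Regular p₁ p₂ L G) :
    meanField (Sum.elim p₁ 0) 𝒢.fieldX = gradX (𝒢.cost₁ p₁) := by
  funext x y
  simp only [meanField, centroid, fieldX, Fintype.sum_sum_type, Sum.elim_inl, Sum.elim_inr,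
    Pi.zero_apply, zero_smul, Finset.sum_const_zero, add_zero]
  exact (gradient_weighted_sum p₁ (fun k => h.diffX (Sum.inl k) y) x).symm

lemma Regular.meanField_fieldY (h : 𝒢.Regular p₁ p₂ L G) :
    meanField (Sum.elim 0 p₂) 𝒢.fieldY = gradY (𝒢.cost₂ p₂) := by
  funext x y
  simp only [meanField, centroid, fieldY, Fintype.sum_sum_type, Sum.elim_inl, Sum.elim_inr,
    Pi.zero_apply, zero_smul, Finset.sum_const_zero, zero_add]
  exact (gradient_weighted_sum p₂ (fun k => h.diffY (Sum.inr k) x) y).symm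

lemma Regular.fieldBounds (h : 𝒢.Regular p₁ p₂ L G) (hL : 0 ≤ L) (hK : Nonempty (Fin K₁)) :
    FieldBounds (Sum.elim p₁ 0) (Sum.elim 0 p₂) 𝒢.fieldX 𝒢.fieldY L G where
  L_nonneg := hL
  G_nonneg := (norm_nonneg _).trans (h.gapX₁ hK.some 0 0)
  lip_x := by
    rintro (k | k)
    · exact h.lipX _
    · exact h.oppLip₁ k
  lip_y := by
    rintro (k | k)
    · exact h.oppLip₂ k
    · exact h.lipY _
  gap_x := by
    rw [h.meanField_fieldX]
    rintro (k | k)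
    · exact h.gapX₁ k
    · exact h.oppGap₁ k
  gap_y := by
    rw [h.meanField_fieldY]
    rintro (k | k)
    · exact h.oppGap₂ k
    · exact h.gapY₂ k

lemma Regular.jointField_eq (h : 𝒢.Regular p₁ p₂ L G) :
    jointField (Sum.elim p₁ 0) (Sum.elim 0 p₂) 𝒢.fieldX 𝒢.fieldY = 𝒢.F p₁ p₂ := by
  funext z
  rw [jointField, h.meanField_fieldX, h.meanField_fieldY]
  rfl

lemma IsNash.field_eq_zero {z : JointStrat M₁ M₂} (h : 𝒢.IsNash p₁ p₂ z) : 𝒢.F p₁ p₂ z = 0 := by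
  have h₁ : gradX (𝒢.cost₁ p₁) z.fst z.snd = 0 :=
    gradient_eq_zero_of_forall_le (f := fun x => 𝒢.cost₁ p₁ x z.snd) h.1
  have h₂ : gradY (𝒢.cost₂ p₂) z.fst z.snd = 0 :=
    gradient_eq_zero_of_forall_le (f := fun y => 𝒢.cost₂ p₂ z.fst y) h.2
  rw [F, h₁, h₂]
  rfl

/-- Testing monotonicity of `F` on two points that differ in one component shows that each team's
cost has monotone gradient in its own strategy. A critical point is then a best response. -/
lemma Regular.isNash_of_field_eq_zero (h : 𝒢.Regular p₁ p₂ L G) {ν : ℝ} (hν : 0 ≤ ν)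
    (hm : 𝒢.StronglyMonotone p₁ p₂ ν) {z : JointStrat M₁ M₂} (hz : 𝒢.F p₁ p₂ z = 0) :
    𝒢.IsNash p₁ p₂ z := by
  refine ⟨le_of_gradient_eq_zero_of_monotone (f := fun x => 𝒢.cost₁ p₁ x z.snd) ?_
    (fun u v => ?_) ?_, le_of_gradient_eq_zero_of_monotone (f := fun y => 𝒢.cost₂ p₂ z.fst y) ?_
    (fun u v => ?_) ?_⟩
  · exact Differentiable.fun_sum fun k _ => (h.diffX (Sum.inl k) z.snd).const_mul (p₁ k)
  · have := (by positivity : 0 ≤ ν * ‖(WithLp.toLp 2 (u, z.snd) : JointStrat M₁ M₂) -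
      WithLp.toLp 2 (v, z.snd)‖ ^ 2).trans (hm (WithLp.toLp 2 (u, z.snd)) (WithLp.toLp 2 (v, z.snd)))
    simpa [WithLp.prod_inner_apply, F, gradX] using this
  · exact congrArg WithLp.fst hz
  · exact Differentiable.fun_sum fun k _ => (h.diffY (Sum.inr k) z.fst).const_mul (p₂ k)
  · have := (by positivity : 0 ≤ ν * ‖(WithLp.toLp 2 (z.fst, u) : JointStrat M₁ M₂) -
      WithLp.toLp 2 (z.fst, v)‖ ^ 2).trans (hm (WithLp.toLp 2 (z.fst, u)) (WithLp.toLp 2 (z.fst, v)))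
    simpa [WithLp.prod_inner_apply, F, gradY] using this
  · exact congrArg WithLp.snd hz

end Game

end CompetingNetworks

/-! ### The algorithm as a run of the two chains. -/

namespace CompetingNetworks

variable {K₁ K₂ M₁ M₂ : ℕ} {Ω : Type*}

/-- The stochastic gradients for the strategy of Team 1. -/
def Oracles.sampleX (𝒪 : Oracles K₁ K₂ M₁ M₂ Ω) (i : ℕ) :
    Agent K₁ K₂ → Strat M₁ → Strat M₂ → Ω → Strat M₁ :=
  Sum.elim (𝒪.own₁ i) (𝒪.opp₁ i)

/-- The stochastic gradients for the strategy of Team 2. -/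
def Oracles.sampleY (𝒪 : Oracles K₁ K₂ M₁ M₂ Ω) (i : ℕ) :
    Agent K₁ K₂ → Strat M₁ → Strat M₂ → Ω → Strat M₂ :=
  Sum.elim (𝒪.opp₂ i) (𝒪.own₂ i)

/-- Team 2 receives the strategies of Team 1 after they have been adapted and combined in the same
iteration, which produces the block `A₁ C₁₂`. -/
lemma iterate_succ_x (N : Network K₁ K₂) (μ : ℝ) (𝒪 : Oracles K₁ K₂ M₁ M₂ Ω) (i : ℕ) (ω : Ω) :
    (iterate N μ 𝒪 (i + 1) ω).x = mix N.chain₁ ((iterate N μ 𝒪 i ω).x - μ • fun k =>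
      𝒪.sampleX i k ((iterate N μ 𝒪 i ω).x k) ((iterate N μ 𝒪 i ω).y k) ω) := by
  funext k
  rcases k with k | k
  · simp [iterate, step, mix, Network.chain₁, Oracles.sampleX]
  · simp only [iterate, step, mix, Network.chain₁, Oracles.sampleX, Fintype.sum_sum_type,
      Sum.elim_inr, Matrix.fromBlocks_apply₁₂, Matrix.fromBlocks_apply₂₂, Matrix.mul_apply,
      Finset.sum_smul, Finset.smul_sum, smul_smul]
    congr 1
    rw [Finset.sum_comm]
    refine Finset.sum_congr rfl fun l _ => Finset.sum_congr rfl fun j _ => ?_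
    rw [mul_comm]
    rfl

lemma iterate_succ_y (N : Network K₁ K₂) (μ : ℝ) (𝒪 : Oracles K₁ K₂ M₁ M₂ Ω) (i : ℕ) (ω : Ω) :
    (iterate N μ 𝒪 (i + 1) ω).y = mix N.chain₂ ((iterate N μ 𝒪 i ω).y - μ • fun k =>
      𝒪.sampleY i k ((iterate N μ 𝒪 i ω).x k) ((iterate N μ 𝒪 i ω).y k) ω) := by
  funext k
  rcases k with k | k
  · simp only [iterate, step, mix, Network.chain₂, Oracles.sampleY, Fintype.sum_sum_type,
      Sum.elim_inl, Matrix.fromBlocks_apply₁₁, Matrix.fromBlocks_apply₂₁, Matrix.mul_apply,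
      Finset.sum_smul, Finset.smul_sum, smul_smul]
    rw [add_comm]
    congr 1
    rw [Finset.sum_comm]
    refine Finset.sum_congr rfl fun l _ => Finset.sum_congr rfl fun j _ => ?_
    rw [mul_comm]
    rfl
  · simp [iterate, step, mix, Network.chain₂, Oracles.sampleY]

lemma measurable_iterate_history (N : Network K₁ K₂) (μ : ℝ) (𝒪 : Oracles K₁ K₂ M₁ M₂ Ω) (i : ℕ)
    (k : Agent K₁ K₂) :
    Measurable[history N μ 𝒪 i] fun ω => ((iterate N μ 𝒪 i ω).x k, (iterate N μ 𝒪 i ω).y k) := by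
  refine measurable_iff_comap_le.2 ?_
  exact le_iSup_of_le i (le_iSup_of_le le_rfl (le_iSup (fun k => MeasurableSpace.comap
    (fun ω => ((iterate N μ 𝒪 i ω).x k, (iterate N μ 𝒪 i ω).y k)) inferInstance) k))

lemma stronglyMeasurable_history_of_continuous {F : Type*} [NormedAddCommGroup F]
    [MeasurableSpace F] [BorelSpace F] [SecondCountableTopology F]
    {H : (Agent K₁ K₂ → Strat M₁) × (Agent K₁ K₂ → Strat M₂) → F} (hH : Continuous H)
    (N : Network K₁ K₂) (μ : ℝ) (𝒪 : Oracles K₁ K₂ M₁ M₂ Ω) (i : ℕ) :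
    StronglyMeasurable[history N μ 𝒪 i]
      fun ω => H ((iterate N μ 𝒪 i ω).x, (iterate N μ 𝒪 i ω).y) := by
  have hm := measurable_iterate_history N μ 𝒪 i
  have h₁ : Measurable[history N μ 𝒪 i] fun ω => (iterate N μ 𝒪 i ω).x :=
    @measurable_pi_lambda _ _ _ (history N μ 𝒪 i) _ _ fun k => measurable_fst.comp (hm k)
  have h₂ : Measurable[history N μ 𝒪 i] fun ω => (iterate N μ 𝒪 i ω).y :=
    @measurable_pi_lambda _ _ _ (history N μ 𝒪 i) _ _ fun k => measurable_snd.comp (hm k)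
  exact (hH.measurable.comp (h₁.prodMk h₂)).stronglyMeasurable

section Noise

variable {ℱ : MeasurableSpace Ω} [mΩ : MeasurableSpace Ω] {P : Measure Ω}
  [IsProbabilityMeasure P] {E : Type*} [NormedAddCommGroup E] [InnerProductSpace ℝ E] [CompleteSpace E]
  {ghat : Strat M₁ → Strat M₂ → Ω → E} {g : Strat M₁ → Strat M₂ → E}
  {σ : ℝ} {x : Ω → Strat M₁} {y : Ω → Strat M₂}

lemma IsUnbiasedEstimate.integral_norm_sq_le (h : IsUnbiasedEstimate P ℱ ghat g σ x y)
    (hℱ : ℱ ≤ mΩ) : ∫ ω, ‖ghat (x ω) (y ω) ω - g (x ω) (y ω)‖ ^ 2 ∂P ≤ σ ^ 2 := by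
  rw [← integral_condExp hℱ]
  refine (integral_mono_ae integrable_condExp (integrable_const _) h.variance).trans ?_
  simp

/-- The noise is orthogonal to everything that is known from the past. -/
lemma IsUnbiasedEstimate.integral_inner_eq_zero (h : IsUnbiasedEstimate P ℱ ghat g σ x y)
    (hℱ : ℱ ≤ mΩ) (hn : MemLp (fun ω => ghat (x ω) (y ω) ω - g (x ω) (y ω)) 2 P)
    (hg : Integrable (fun ω => g (x ω) (y ω)) P)
    (hgm : StronglyMeasurable[ℱ] fun ω => g (x ω) (y ω)) {H : Ω → E}
    (hH : StronglyMeasurable[ℱ] H) (hH₂ : MemLp H 2 P) :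
    ∫ ω, inner ℝ (H ω) (ghat (x ω) (y ω) ω - g (x ω) (y ω)) ∂P = 0 := by
  have hni : Integrable (fun ω => ghat (x ω) (y ω) ω - g (x ω) (y ω)) P :=
    hn.integrable one_le_two
  have hgi : Integrable (fun ω => ghat (x ω) (y ω) ω) P :=
    (hni.add hg).congr (ae_of_all _ fun ω => by simp)
  have h₀ : P[fun ω => ghat (x ω) (y ω) ω - g (x ω) (y ω) | ℱ] =ᵐ[P] 0 := by
    have h₁ := condExp_sub hgi hg ℱ
    rw [condExp_of_stronglyMeasurable hℱ hgm hg] at h₁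
    filter_upwards [h₁, h.unbiased] with ω h₂ h₃
    change (P[(fun ω => ghat (x ω) (y ω) ω) - fun ω => g (x ω) (y ω) | ℱ]) ω = 0
    rw [h₂, Pi.sub_apply, h₃, sub_self]
  -- The factor known from the past comes out of the conditional expectation, which leaves the
  -- conditional mean of the noise, namely zero.
  have h₄ := condExp_bilin_of_stronglyMeasurable_left (innerSL ℝ) hH
    (integrable_inner_of_memLp hH₂ hn) hni
  rw [← integral_condExp hℱ]
  refine (integral_congr_ae (h₄.trans ?_)).trans (integral_zero Ω ℝ)
  filter_upwards [h₀] with ω h₅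
  rw [h₅]
  simp

end Noise

section Admissible

variable [mΩ : MeasurableSpace Ω] {P : Measure Ω}
  {N : Network K₁ K₂} {𝒢 : Game K₁ K₂ M₁ M₂} {𝒪 : Oracles K₁ K₂ M₁ M₂ Ω}
  {p₁ : Fin K₁ → ℝ} {p₂ : Fin K₂ → ℝ} {L G μ σ : ℝ}

/-- The error of the stochastic gradients for the strategy of Team 1, at the iterates. -/
noncomputable def noiseX (N : Network K₁ K₂) (𝒢 : Game K₁ K₂ M₁ M₂) (𝒪 : Oracles K₁ K₂ M₁ M₂ Ω)
    (μ : ℝ) (i : ℕ) (ω : Ω) (k : Agent K₁ K₂) : Strat M₁ :=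
  𝒪.sampleX i k ((iterate N μ 𝒪 i ω).x k) ((iterate N μ 𝒪 i ω).y k) ω -
    𝒢.fieldX k ((iterate N μ 𝒪 i ω).x k) ((iterate N μ 𝒪 i ω).y k)

/-- The error of the stochastic gradients for the strategy of Team 2, at the iterates. -/
noncomputable def noiseY (N : Network K₁ K₂) (𝒢 : Game K₁ K₂ M₁ M₂) (𝒪 : Oracles K₁ K₂ M₁ M₂ Ω)
    (μ : ℝ) (i : ℕ) (ω : Ω) (k : Agent K₁ K₂) : Strat M₂ :=
  𝒪.sampleY i k ((iterate N μ 𝒪 i ω).x k) ((iterate N μ 𝒪 i ω).y k) ω -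
    𝒢.fieldY k ((iterate N μ 𝒪 i ω).x k) ((iterate N μ 𝒪 i ω).y k)

namespace Oracles.IsAdmissible

lemma measurable_sampleX (h : 𝒪.IsAdmissible N 𝒢 μ σ P) (i : ℕ) (k : Agent K₁ K₂) :
    Measurable fun q : Strat M₁ × Strat M₂ × Ω => 𝒪.sampleX i k q.1 q.2.1 q.2.2 := by
  rcases k with k | k
  · exact h.meas_own₁ i k
  · exact h.meas_opp₁ i k

lemma measurable_sampleY (h : 𝒪.IsAdmissible N 𝒢 μ σ P) (i : ℕ) (k : Agent K₁ K₂) :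
    Measurable fun q : Strat M₁ × Strat M₂ × Ω => 𝒪.sampleY i k q.1 q.2.1 q.2.2 := by
  rcases k with k | k
  · exact h.meas_opp₂ i k
  · exact h.meas_own₂ i k

lemma estimate_x (h : 𝒪.IsAdmissible N 𝒢 μ σ P) (i : ℕ) (k : Agent K₁ K₂) :
    IsUnbiasedEstimate P (history N μ 𝒪 i) (𝒪.sampleX i k) (𝒢.fieldX k) σ
      (fun ω => (iterate N μ 𝒪 i ω).x k) fun ω => (iterate N μ 𝒪 i ω).y k := by
  rcases k with k | k
  · exact h.noise_own₁ i k
  · exact h.noise_opp₁ i k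

lemma estimate_y (h : 𝒪.IsAdmissible N 𝒢 μ σ P) (i : ℕ) (k : Agent K₁ K₂) :
    IsUnbiasedEstimate P (history N μ 𝒪 i) (𝒪.sampleY i k) (𝒢.fieldY k) σ
      (fun ω => (iterate N μ 𝒪 i ω).x k) fun ω => (iterate N μ 𝒪 i ω).y k := by
  rcases k with k | k
  · exact h.noise_opp₂ i k
  · exact h.noise_own₂ i k

lemma measurable_iterate (h : 𝒪.IsAdmissible N 𝒢 μ σ P) (i : ℕ) :
    (∀ k, Measurable fun ω => (iterate N μ 𝒪 i ω).x k) ∧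
      ∀ k, Measurable fun ω => (iterate N μ 𝒪 i ω).y k := by
  induction i with
  | zero => exact ⟨fun _ => measurable_const, fun _ => measurable_const⟩
  | succ i ih =>
    refine ⟨fun k => ?_, fun k => ?_⟩
    · simp only [iterate_succ_x, mix]
      exact Finset.measurable_fun_sum _ fun l _ => ((ih.1 l).sub (((h.measurable_sampleX i l).comp
        ((ih.1 l).prodMk ((ih.2 l).prodMk measurable_id))).const_smul μ)).const_smul (N.chain₁ l k)
    · simp only [iterate_succ_y, mix]
      exact Finset.measurable_fun_sum _ fun l _ => ((ih.2 l).sub (((h.measurable_sampleY i l).comp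
        ((ih.1 l).prodMk ((ih.2 l).prodMk measurable_id))).const_smul μ)).const_smul (N.chain₂ l k)

lemma history_le (h : 𝒪.IsAdmissible N 𝒢 μ σ P) (i : ℕ) : history N μ 𝒪 i ≤ mΩ :=
  iSup_le fun j => iSup_le fun _ => iSup_le fun k =>
    (((h.measurable_iterate j).1 k).prodMk ((h.measurable_iterate j).2 k)).comap_le

end Oracles.IsAdmissible

namespace Oracles.IsAdmissible

lemma isChain (h : 𝒪.IsAdmissible N 𝒢 μ σ P)
    (hg : FieldBounds (Sum.elim p₁ 0) (Sum.elim 0 p₂) 𝒢.fieldX 𝒢.fieldY L G) :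
    IsChain N.chain₁ N.chain₂ 𝒢.fieldX 𝒢.fieldY μ P (fun i ω => (iterate N μ 𝒪 i ω).x)
      (fun i ω => (iterate N μ 𝒪 i ω).y) (noiseX N 𝒢 𝒪 μ) (noiseY N 𝒢 𝒪 μ) where
  x_zero _ := rfl
  y_zero _ := rfl
  x_succ i ω := by
    simp only [iterate_succ_x, noiseX, add_sub_cancel]
  y_succ i ω := by
    simp only [iterate_succ_y, noiseY, add_sub_cancel]
  memLp_nx i k := by
    have hm := h.measurable_iterate i
    refine (memLp_two_iff_integrable_sq_norm (Measurable.aestronglyMeasurable ?_)).2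
      (h.estimate_x i k).integrable
    exact ((h.measurable_sampleX i k).comp ((hm.1 k).prodMk ((hm.2 k).prodMk measurable_id))).sub
      ((hg.lip_x k).continuous.measurable.comp ((hm.1 k).prodMk (hm.2 k)))
  memLp_ny i k := by
    have hm := h.measurable_iterate i
    refine (memLp_two_iff_integrable_sq_norm (Measurable.aestronglyMeasurable ?_)).2
      (h.estimate_y i k).integrable
    exact ((h.measurable_sampleY i k).comp ((hm.1 k).prodMk ((hm.2 k).prodMk measurable_id))).sub
      ((hg.lip_y k).continuous.measurable.comp ((hm.1 k).prodMk (hm.2 k)))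

variable [IsProbabilityMeasure P]

/-- The algorithm with admissible stochastic gradients is a run of the two averaging chains. -/
lemma isRun (h : 𝒪.IsAdmissible N 𝒢 μ σ P)
    (hg : FieldBounds (Sum.elim p₁ 0) (Sum.elim 0 p₂) 𝒢.fieldX 𝒢.fieldY L G) :
    IsRun N.chain₁ N.chain₂ 𝒢.fieldX 𝒢.fieldY μ σ P (fun i ω => (iterate N μ 𝒪 i ω).x)
      (fun i ω => (iterate N μ 𝒪 i ω).y) (noiseX N 𝒢 𝒪 μ) (noiseY N 𝒢 𝒪 μ) where
  toIsChain := h.isChain hg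
  nx_le i k := (h.estimate_x i k).integral_norm_sq_le (h.history_le i)
  ny_le i k := (h.estimate_y i k).integral_norm_sq_le (h.history_le i)
  nx_orth i k H hH hH₂ := by
    -- Orthogonality requires integrable gradients at the iterates, hence square-integrable
    -- iterates. These follow from the chain structure alone, without orthogonality.
    have hm := (h.isChain hg).memLp hg i
    exact (h.estimate_x i k).integral_inner_eq_zero (h.history_le i)
      ((h.isChain hg).memLp_nx i k)
      (((hg.lip_x k).memLp hg.L_nonneg (hm.1 k) (hm.2 k)).integrable one_le_two)
      (stronglyMeasurable_history_of_continuous (H := fun s => 𝒢.fieldX k (s.1 k) (s.2 k))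
        ((hg.lip_x k).continuous.comp (by fun_prop : Continuous fun s :
          (Agent K₁ K₂ → Strat M₁) × (Agent K₁ K₂ → Strat M₂) => (s.1 k, s.2 k))) N μ 𝒪 i)
      (stronglyMeasurable_history_of_continuous hH N μ 𝒪 i) hH₂
  ny_orth i k H hH hH₂ := by
    have hm := (h.isChain hg).memLp hg i
    exact (h.estimate_y i k).integral_inner_eq_zero (h.history_le i)
      ((h.isChain hg).memLp_ny i k)
      (((hg.lip_y k).memLp hg.L_nonneg (hm.1 k) (hm.2 k)).integrable one_le_two)
      (stronglyMeasurable_history_of_continuous (H := fun s => 𝒢.fieldY k (s.1 k) (s.2 k))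
        ((hg.lip_y k).continuous.comp (by fun_prop : Continuous fun s :
          (Agent K₁ K₂ → Strat M₁) × (Agent K₁ K₂ → Strat M₂) => (s.1 k, s.2 k))) N μ 𝒪 i)
      (stronglyMeasurable_history_of_continuous hH N μ 𝒪 i) hH₂

end Oracles.IsAdmissible

end Admissible

end CompetingNetworks

/-! ### Translation of centroids and consensus error; final assembly. -/

namespace CompetingNetworks

namespace State

variable {K₁ K₂ M₁ M₂ : ℕ}

lemma xc_eq_centroid (s : State K₁ K₂ M₁ M₂) (p₁ : Fin K₁ → ℝ) :
    s.xc p₁ = centroid (Sum.elim p₁ 0) s.x := by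
  simp [xc, centroid]

lemma yc_eq_centroid (s : State K₁ K₂ M₁ M₂) (p₂ : Fin K₂ → ℝ) :
    s.yc p₂ = centroid (Sum.elim 0 p₂) s.y := by
  simp [yc, centroid]

lemma zc_eq_jointCentroid (s : State K₁ K₂ M₁ M₂) (p₁ : Fin K₁ → ℝ) (p₂ : Fin K₂ → ℝ) :
    s.zc p₁ p₂ = jointCentroid (Sum.elim p₁ 0) (Sum.elim 0 p₂) s.x s.y := by
  rw [zc, xc_eq_centroid, yc_eq_centroid]
  rfl

lemma consensusError_eq_sum (s : State K₁ K₂ M₁ M₂) (p₁ : Fin K₁ → ℝ) (p₂ : Fin K₂ → ℝ) :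
    s.consensusError p₁ p₂ = ∑ k, (‖s.x k - centroid (Sum.elim p₁ 0) s.x‖ ^ 2 +
      ‖s.y k - centroid (Sum.elim 0 p₂) s.y‖ ^ 2) := by
  rw [consensusError, xc_eq_centroid, yc_eq_centroid, Finset.sum_add_distrib,
    Fintype.sum_sum_type, Fintype.sum_sum_type]
  ring

end State

section Run

variable {ι : Type*} [Fintype ι] {M₁ M₂ : ℕ} {Ω : Type*} [MeasurableSpace Ω]
  {Bx By : Matrix ι ι ℝ} {qx qy : ι → ℝ} {gx : ι → Strat M₁ → Strat M₂ → Strat M₁}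
  {gy : ι → Strat M₁ → Strat M₂ → Strat M₂} {L G μ σ : ℝ} {P : Measure Ω}
  {x : ℕ → Ω → ι → Strat M₁} {y : ℕ → Ω → ι → Strat M₂}
  {nx : ℕ → Ω → ι → Strat M₁} {ny : ℕ → Ω → ι → Strat M₂}
  [IsProbabilityMeasure P] {α Γ : ℝ} {Wx : (ι → Strat M₁) → ℝ} {Wy : (ι → Strat M₂) → ℝ}
  [DecidableEq ι]

/-- Mean-square consensus around the centroids. -/
theorem IsRun.integral_consensus_le (h : IsRun Bx By gx gy μ σ P x y nx ny)
    (hg : FieldBounds qx qy gx gy L G) (hBx : IsErgodic Bx qx) (hBy : IsErgodic By qy)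
    (hWx : IsContractedBy (deviation Bx qx) α Γ Wx)
    (hWy : IsContractedBy (deviation By qy) α Γ Wy) (hα : 0 < α) (hα₁ : α < 1) (hΓ : 0 ≤ Γ)
    (hμ : 0 ≤ μ) (hμs : μ * (2 * Γ * L) ≤ (1 - α) / 2) (i : ℕ) :
    Integrable (fun ω => ∑ k, (‖x i ω k - centroid qx (x i ω)‖ ^ 2 +
      ‖y i ω k - centroid qy (y i ω)‖ ^ 2)) P ∧
    ∫ ω, ∑ k, (‖x i ω k - centroid qx (x i ω)‖ ^ 2 + ‖y i ω k - centroid qy (y i ω)‖ ^ 2) ∂P ≤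
      Fintype.card ι * consensusConst (Fintype.card ι) α Γ G σ * μ ^ 2 := by
  have hm := h.memLp hg i
  have hint : Integrable (fun ω => ∑ k, (‖x i ω k - centroid qx (x i ω)‖ ^ 2 +
      ‖y i ω k - centroid qy (y i ω)‖ ^ 2)) P :=
    integrable_finsetSum _ fun k _ =>
      (integrable_norm_sq_of_memLp ((hm.1 k).sub (memLp_centroid qx hm.1))).add
        (integrable_norm_sq_of_memLp ((hm.2 k).sub (memLp_centroid qy hm.2)))
  refine ⟨hint, ?_⟩
  have hV := (h.memLp_errSize hg hWx hWy i).integrable_sq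
  calc _ ≤ ∫ ω, Fintype.card ι * errSize Wx Wy qx qy (x i ω) (y i ω) ^ 2 ∂P := by
        refine integral_mono hint (hV.const_mul _) fun ω => ?_
        have hk : ∀ k ∈ Finset.univ, ‖x i ω k - centroid qx (x i ω)‖ ^ 2 +
            ‖y i ω k - centroid qy (y i ω)‖ ^ 2 ≤
              errSize Wx Wy qx qy (x i ω) (y i ω) ^ 2 := by
          intro k _
          have h₁ := pow_le_pow_left₀ (by positivity)
            (norm_dev_add_le_errSize hWx hWy (x i ω) (y i ω) k) 2
          have h₂ := mul_nonneg (norm_nonneg (x i ω k - centroid qx (x i ω)))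
            (norm_nonneg (y i ω k - centroid qy (y i ω)))
          linarith
        refine (Finset.sum_le_sum hk).trans (le_of_eq ?_)
        rw [Finset.sum_const, Finset.card_univ, nsmul_eq_mul]
    _ ≤ _ := by
        rw [integral_const_mul]
        have := mul_le_mul_of_nonneg_left (h.integral_errSize_sq_le hg hBx hBy hWx hWy hα hα₁ hΓ
          hμ hμs i) (Nat.cast_nonneg (α := ℝ) (Fintype.card ι))
        linarith

end Run

lemma IsErgodic.exists_isContractedBy {ι : Type*} [Fintype ι] [DecidableEq ι] {B : Matrix ι ι ℝ}
    {q : ι → ℝ} (h : IsErgodic B q) :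
    ∃ ρ : ℝ, 0 < ρ ∧ ρ < 1 ∧ ∃ Γ : ℝ, 0 ≤ Γ ∧
      ∀ (E : Type) [NormedAddCommGroup E] [NormedSpace ℝ E],
        ∃ W : (ι → E) → ℝ, IsContractedBy (deviation B q) ρ Γ W := by
  obtain ⟨m, hm, hD⟩ := h.exists_deviation_pow_le_half
  exact exists_isContractedBy_of_pow_le_half hm hD

lemma IsPerronVector.nonempty {K : ℕ} {A : Matrix (Fin K) (Fin K) ℝ} {p : Fin K → ℝ}
    (h : IsPerronVector A p) : Nonempty (Fin K) := by
  by_contra hempty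
  rw [not_nonempty_iff] at hempty
  simpa using h.sum_eq_one

end CompetingNetworks

theorem corollary1 :
    -- the contraction factor `d μ ν L` depends on the step size, `ν` and `L` only
    ∃ d : ℝ → ℝ → ℝ → ℝ,
    ∀ (K₁ K₂ : ℕ) (N : Network K₁ K₂) (p₁ : Fin K₁ → ℝ) (p₂ : Fin K₂ → ℝ),
      N.IsWeak → IsPerronVector N.A₁ p₁ → IsPerronVector N.A₂ p₂ →
    -- `α` depends on the network matrices only
    ∃ α : ℝ, 0 < α ∧ α < 1 ∧
    ∀ (M₁ M₂ : ℕ) (𝒢 : Game K₁ K₂ M₁ M₂) (L G σ κ : ℝ),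
      0 ≤ L → 𝒢.Regular p₁ p₂ L G → 0 < κ →
    -- consensus and learning dynamics, without strong monotonicity
    (∃ μ₀ > 0, ∃ B ≥ 0, ∀ μ : ℝ, 0 < μ → μ < μ₀ →
      ∀ (Ω : Type u) [MeasurableSpace Ω] (P : Measure Ω) [IsProbabilityMeasure P]
        (𝒪 : Oracles K₁ K₂ M₁ M₂ Ω), 𝒪.IsAdmissible N 𝒢 μ σ P →
        (∀ i : ℕ, transient α κ μ ≤ i →
          Integrable (fun ω => (iterate N μ 𝒪 (i + 1) ω).consensusError p₁ p₂) P ∧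
          ∫ ω, (iterate N μ 𝒪 (i + 1) ω).consensusError p₁ p₂ ∂P ≤ B * μ ^ 2) ∧
        ∃ r : ℕ → Ω → JointStrat M₁ M₂, ∀ i : ℕ, transient α κ μ ≤ i →
          (∀ ω, (iterate N μ 𝒪 (i + 1) ω).zc p₁ p₂ =
            (iterate N μ 𝒪 i ω).zc p₁ p₂ - μ • 𝒢.F p₁ p₂ ((iterate N μ 𝒪 i ω).zc p₁ p₂)
              + r i ω) ∧
          Integrable (fun ω => ‖r i ω‖ ^ 2) P ∧
          ∫ ω, ‖r i ω‖ ^ 2 ∂P ≤ B * μ ^ 2) ∧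
    -- mean-square-error stability around the unique Nash equilibrium
    (∀ ν : ℝ, 0 < ν → 𝒢.StronglyMonotone p₁ p₂ ν →
      ∃ zs : JointStrat M₁ M₂, 𝒢.IsNash p₁ p₂ zs ∧ (∀ z, 𝒢.IsNash p₁ p₂ z → z = zs) ∧
      ∃ μ₀ > 0, ∃ B ≥ 0, ∀ μ : ℝ, 0 < μ → μ < μ₀ →
        0 ≤ d μ ν L ∧ d μ ν L < 1 ∧
        ∀ (Ω : Type u) [MeasurableSpace Ω] (P : Measure Ω) [IsProbabilityMeasure P]
          (𝒪 : Oracles K₁ K₂ M₁ M₂ Ω), 𝒪.IsAdmissible N 𝒢 μ σ P →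
          (∀ i : ℕ, Integrable (fun ω => ‖(iterate N μ 𝒪 i ω).zc p₁ p₂ - zs‖ ^ 2) P) ∧
          (∀ i : ℕ, transient α κ μ ≤ i →
            ∫ ω, ‖(iterate N μ 𝒪 (i + 1) ω).zc p₁ p₂ - zs‖ ^ 2 ∂P ≤
              d μ ν L * ∫ ω, ‖(iterate N μ 𝒪 i ω).zc p₁ p₂ - zs‖ ^ 2 ∂P + B * μ ^ 2) ∧
          IsBoundedUnder (· ≤ ·) atTop
            (fun i : ℕ => ∫ ω, ‖(iterate N μ 𝒪 i ω).zc p₁ p₂ - zs‖ ^ 2 ∂P) ∧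
          limsup (fun i : ℕ => ∫ ω, ‖(iterate N μ 𝒪 i ω).zc p₁ p₂ - zs‖ ^ 2 ∂P) atTop ≤
            B * μ) := by
  -- The Lipschitz constant acts only through the bound on the step size.
  refine ⟨fun μ ν _ => 1 - ν * μ / 2, fun K₁ K₂ N p₁ p₂ hN hp₁ hp₂ => ?_⟩
  have hBx := hN.isErgodic₁ hp₁
  have hBy := hN.isErgodic₂ hp₂
  obtain ⟨ρ₁, hρ₁, hρ₁', Γ₁, hΓ₁, hW₁⟩ := hBx.exists_isContractedBy
  obtain ⟨ρ₂, -, hρ₂', Γ₂, -, hW₂⟩ := hBy.exists_isContractedBy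
  have hα : 0 < max ρ₁ ρ₂ := lt_max_of_lt_left hρ₁
  have hα₁ : max ρ₁ ρ₂ < 1 := max_lt hρ₁' hρ₂'
  refine ⟨max ρ₁ ρ₂, hα, hα₁, fun M₁ M₂ 𝒢 L G σ κ hL hR _ => ?_⟩
  set α := max ρ₁ ρ₂
  set Γ := max Γ₁ Γ₂
  have hΓ : 0 ≤ Γ := hΓ₁.trans (le_max_left _ _)
  obtain ⟨Wx, hWx⟩ := hW₁ (Strat M₁)
  obtain ⟨Wy, hWy⟩ := hW₂ (Strat M₂)
  replace hWx := hWx.mono (le_max_left ρ₁ ρ₂) (le_max_left Γ₁ Γ₂)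
  replace hWy := hWy.mono (le_max_right ρ₁ ρ₂) (le_max_right Γ₁ Γ₂)
  have hg := hR.fieldBounds hL hp₁.nonempty
  set n := Fintype.card (Agent K₁ K₂)
  set K := consensusConst n α Γ G σ
  have hK : 0 ≤ K := consensusConst_nonneg n α Γ G σ
  -- The summand `1` keeps the denominator positive when `Γ L = 0`.
  set μ₁ : ℝ := min 1 ((1 - α) / 2 / (2 * Γ * L + 1))
  have hden : 0 < 2 * Γ * L + 1 := by positivity
  have hμ₁ : 0 < μ₁ := lt_min one_pos (div_pos (by linarith) hden)
  have hsmall : ∀ μ : ℝ, 0 < μ → μ < μ₁ → μ ≤ 1 ∧ μ * (2 * Γ * L) ≤ (1 - α) / 2 := by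
    intro μ hμ hlt
    refine ⟨(hlt.trans_le (min_le_left _ _)).le, ?_⟩
    have := (le_div_iff₀ hden).1 (hlt.trans_le (min_le_right _ _)).le
    linarith
  refine ⟨⟨μ₁, hμ₁, n * K + (8 * L ^ 2 * K + 32 * n ^ 2 * σ ^ 2), by positivity,
    fun μ hμ hlt Ω _ P _ 𝒪 h𝒪 => ?_⟩, fun ν hν hm => ?_⟩
  · obtain ⟨hle, hs⟩ := hsmall μ hμ hlt
    have hrun := h𝒪.isRun hg
    constructor
    · intro i _
      have h := hrun.integral_consensus_le hg hBx hBy hWx hWy hα hα₁ hΓ hμ.le hs (i + 1)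
      simp only [State.consensusError_eq_sum]
      refine ⟨h.1, h.2.trans (mul_le_mul_of_nonneg_right ?_ (sq_nonneg μ))⟩
      exact le_add_of_nonneg_right (by positivity)
    -- The perturbation is defined as the residual of the gradient step, so its mean-square bound is
    -- the whole content.
    · refine ⟨fun i ω => (iterate N μ 𝒪 (i + 1) ω).zc p₁ p₂ -
        ((iterate N μ 𝒪 i ω).zc p₁ p₂ - μ • 𝒢.F p₁ p₂ ((iterate N μ 𝒪 i ω).zc p₁ p₂)),
        fun i _ => ⟨fun ω => (add_sub_cancel _ _).symm, ?_⟩⟩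
      have h := hrun.integral_dynamics_error_sq_le hg hBx hBy hWx hWy hα hα₁ hΓ hμ.le hle hs i
      rw [hR.jointField_eq] at h
      simp only [State.zc_eq_jointCentroid]
      refine ⟨h.1, h.2.trans (mul_le_mul_of_nonneg_right ?_ (sq_nonneg μ))⟩
      exact le_add_of_nonneg_left (by positivity)
  · have hlip : ∀ z w, ‖𝒢.F p₁ p₂ z - 𝒢.F p₁ p₂ w‖ ≤ 4 * L * ‖z - w‖ := by
      have := norm_jointField_sub_le hg hBx.nonneg hBx.sum_eq_one hBy.nonneg hBy.sum_eq_one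
      rwa [hR.jointField_eq] at this
    obtain ⟨zs, hzs⟩ := exists_zero_of_strongly_monotone hν hlip hm
    refine ⟨zs, hR.isNash_of_field_eq_zero hν.le hm hzs,
      fun z hz => eq_of_strongly_monotone hν hm hz.field_eq_zero hzs, ?_⟩
    set B : ℝ := 4 * L ^ 2 * (1 + 1 / ν) * K + 16 * n ^ 2 * σ ^ 2
    have hB : 0 ≤ B := by positivity
    -- The term `B` serves the one-step recursion. The term `2 B / ν` serves the limsup, as `B μ²`
    -- divided by `1 - d = ν μ / 2`.
    refine ⟨min μ₁ (min (1 / ν) (ν / (64 * L ^ 2 + 1))), by positivity, B + 2 * B / ν,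
      by positivity, fun μ hμ hlt => ?_⟩
    obtain ⟨hle, hs⟩ := hsmall μ hμ (hlt.trans_le (min_le_left _ _))
    have hlt' := hlt.trans_le (min_le_right _ _)
    have hνμ : ν * μ ≤ 1 := by
      have := (le_div_iff₀ hν).1 (hlt'.trans_le (min_le_left _ _)).le
      linarith
    have hLμ : 64 * L ^ 2 * μ ≤ ν := by
      have := (le_div_iff₀ (by positivity)).1 (hlt'.trans_le (min_le_right _ _)).le
      linarith
    have hνμ0 : 0 < ν * μ := by positivity
    have hd : 0 ≤ 1 - ν * μ / 2 := by linarith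
    have hd₁ : 1 - ν * μ / 2 < 1 := by linarith
    refine ⟨hd, hd₁, fun Ω _ P _ 𝒪 h𝒪 => ?_⟩
    have hrun := h𝒪.isRun hg
    have hstep := hrun.integral_dist_zero_sq_le hg hBx hBy hWx hWy hα hα₁ hΓ hμ.le hle hs hν hLμ
      (zs := zs) (by rw [hR.jointField_eq]; exact hzs) (by rw [hR.jointField_eq]; exact hm)
    simp only [State.zc_eq_jointCentroid]
    have hlim := limsup_le_of_contractive (u := fun i => ∫ ω, ‖jointCentroid (Sum.elim p₁ 0)
      (Sum.elim 0 p₂) (iterate N μ 𝒪 i ω).x (iterate N μ 𝒪 i ω).y - zs‖ ^ 2 ∂P) hd hd₁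
      (fun i => integral_nonneg fun ω => sq_nonneg _) hstep
    refine ⟨fun i => integrable_norm_sq_of_memLp
      ((hrun.memLp_jointCentroid hg i).sub (memLp_const zs)), fun i _ => ?_, hlim.1,
      hlim.2.trans ?_⟩
    · refine (hstep i).trans (add_le_add_right (mul_le_mul_of_nonneg_right ?_ (sq_nonneg μ)) _)
      exact le_add_of_nonneg_right (by positivity)
    · have : B * μ ^ 2 / (1 - (1 - ν * μ / 2)) = 2 * B / ν * μ := by
        field_simp
        ring
      change B * μ ^ 2 / (1 - (1 - ν * μ / 2)) ≤ _
      rw [this]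
      exact mul_le_mul_of_nonneg_right (le_add_of_nonneg_left hB) hμ.le
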